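/- Let \((F_i)_{i\in I}\) be a class of finite fields. Say that exponent \(\tau\) is achieved over the class if there is a constant \(C\) such that for all \(i\in I\) and \(m\ge 1\) the product of two \(m\times m\) matrices over \(F_i\) can be computed by a bilinear algebraic algorithm of rank at most \(C m^{\tau}\), and let \(\omega\) be the exponent of matrix multiplication over the class, i.e. the least \(\tau\) such that \(\tau+\varepsilon\) is achieved for every \(\varepsilon>0\). Fix constants \(c>0\), \(K\) and \(k\), and consider all \(n\ge 1\) and \(F=F_i\) with \[ c\,n^2\log n\le |F|\le K n^{k}. \] Consider the congested clique with \(n\) nodes: in each synchronous round every node sends one message of \(\beta\lceil\log_2 n\rceil\) bits to every node (\(\beta\ge1\) any fixed integer), nodes have private randomness, and local computation is free. Consider the following three problems, where initially node \(\ell\) knows the \(\ell\)-th row and the \(\ell\)-th column of a matrix \(A\in F^{n\times n}\). - \(\mathrm{DET}(n,F)\): every node outputs \(\det A\). - \(\mathrm{SYS}(n,F)\): \(A\) is invertible, every node also knows a vector \(b\in F^n\), and node \(\ell\) outputs \(x[\ell]\), where \(Ax=b\). - \(\mathrm{Rank}(n,F)\): every node outputs \(\mathrm{rank}(A)\). Each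 of the three problems is solved by randomized algorithms in \(O(n^{1-2/\omega}\log n)\) rounds, where, as usual, \(n^{\omega}\) stands for \(n^{\omega+o(1)}\): precisely, in \(O(n^{1-2/\omega+\varepsilon}\log n)\) rounds for every \(\varepsilon>0\), and in \(O(n^{1-2/\tau}\log n)\) rounds for every achieved exponent \(\tau\). On every input the outputs of all nodes are correct except with probability at most \(\min\{1/3,\,O(1/\log n)\}\). The implied constants do not depend on \(n\) or on the field in the class. -/

import Mathlib

universe u v w

/-! ## The congested clique model -/

namespace CongestedClique

/-- A message: a bit string of length `β * ⌈log₂ n⌉`, i.e. `O(log n)` bits. -/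
abbrev Message (β n : ℕ) : Type := Fin (β * Nat.clog 2 n) → Bool

/-- A distributed problem for a network of `n` nodes: which part of the instance each node knows
initially, and which families of local outputs are correct for an instance. -/
structure Problem (n : ℕ) where
  Instance : Type u
  LocalInput : Type u
  LocalOutput : Type w
  localInput : Instance → Fin n → LocalInput
  Correct : Instance → (Fin n → LocalOutput) → Prop

/-- A randomized algorithm in the congested clique with `n` nodes. Every node has private coins,
drawn uniformly from a finite set, and a state that initially depends only on its own input and
its own coins. In each synchronous round every node sends one message to every node, and then
updates its state with the messages it received. Local computation is unrestricted. -/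
structure Protocol (n β : ℕ) (LocalInput : Type u) (LocalOutput : Type w) where
  Coin : Type u
  coin_finite : Finite Coin
  coin_nonempty : Nonempty Coin
  State : Type u
  init : Fin n → LocalInput → Coin → State
  /-- `send ℓ s ℓ'` is the message that node `ℓ` in state `s` sends to node `ℓ'`. -/
  send : Fin n → State → Fin n → Message β n
  /-- `receive ℓ s m` is the new state of node `ℓ` in state `s`; `m ℓ'` comes from node `ℓ'`. -/
  receive : Fin n → State → (Fin n → Message β n) → State
  output : Fin n → State → LocalOutput

namespace Protocol

variable {n β : ℕ} {I : Type u} {O : Type w}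

/-- The states of all nodes after `t` rounds. -/
def stateAfter (P : Protocol n β I O) (x : Fin n → I) (r : Fin n → P.Coin) :
    ℕ → Fin n → P.State
  | 0 => fun l => P.init l (x l) (r l)
  | t + 1 => fun l =>
      P.receive l (stateAfter P x r t l) (fun l' => P.send l' (stateAfter P x r t l') l)

/-- The outputs of all nodes when the protocol is stopped after `T` rounds. -/
def run (P : Protocol n β I O) (T : ℕ) (x : Fin n → I) (r : Fin n → P.Coin) : Fin n → O :=
  fun l => P.output l (P.stateAfter x r T l)

end Protocol

/-- The probability, over independent uniform coins of the nodes, that the outputs after `T` rounds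
on instance `X` are not correct. -/
noncomputable def failureProb {n β : ℕ} (prob : Problem.{u, w} n)
    (P : Protocol n β prob.LocalInput prob.LocalOutput) (T : ℕ) (X : prob.Instance) : ℝ :=
  (Set.ncard {r : Fin n → P.Coin | ¬ prob.Correct X (P.run T (prob.localInput X) r)} : ℝ) /
    (Nat.card (Fin n → P.Coin) : ℝ)

/-- Some protocol with messages of `β * ⌈log₂ n⌉` bits solves the problem in `T` rounds, with
failure probability at most `δ` on every instance. -/
def SolvableInRounds {n : ℕ} (prob : Problem.{u, w} n) (β T : ℕ) (δ : ℝ) : Prop :=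
  ∃ P : Protocol n β prob.LocalInput prob.LocalOutput,
    ∀ X : prob.Instance, failureProb prob P T X ≤ δ

/-- The problems `prob n i`, for the pairs `(n, i)` in `Adm`, have randomized round complexity
`O(f n)`: up to `C * f n` rounds, and failure probability at most `1/3` and at most `D / log n`.
The constants do not depend on `n` and `i`. -/
def RandomizedRoundComplexityO {ι : Type v} (Adm : ℕ → ι → Prop)
    (prob : (n : ℕ) → ι → Problem.{u, w} n) (β : ℕ) (f : ℕ → ℝ) : Prop :=
  ∃ C D : ℝ, ∀ (n : ℕ) (i : ι), Adm n i →
    ∃ (T : ℕ) (δ : ℝ), (T : ℝ) ≤ C * f n ∧ δ ≤ 1 / 3 ∧ δ * Real.log n ≤ D ∧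
      SolvableInRounds (prob n i) β T δ

/-! ## The algebraic problems -/

/-- Node `l` knows the row `A[l,*]` and the column `A[*,l]`. -/
def rowAndColumn {n : ℕ} {F : Type u} (A : Matrix (Fin n) (Fin n) F) (l : Fin n) :
    (Fin n → F) × (Fin n → F) :=
  (fun j => A l j, fun j => A j l)

/-- Determinant: every node outputs `det A`. -/
def DET (n : ℕ) (F : Type u) [Field F] : Problem.{u, u} n where
  Instance := Matrix (Fin n) (Fin n) F
  LocalInput := (Fin n → F) × (Fin n → F)
  LocalOutput := F
  localInput := rowAndColumn
  Correct A out := ∀ l, out l = A.det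

/-- Rank: every node outputs `rank A`. -/
def RANK (n : ℕ) (F : Type u) [Field F] : Problem.{u, 0} n where
  Instance := Matrix (Fin n) (Fin n) F
  LocalInput := (Fin n → F) × (Fin n → F)
  LocalOutput := ℕ
  localInput := rowAndColumn
  Correct A out := ∀ l, out l = A.rank

/-- Nonsingular linear system: every node also knows `b`, and node `l` outputs `x l`, where
`A x = b`. -/
def SYS (n : ℕ) (F : Type u) [Field F] : Problem.{u, u} n where
  Instance := {A : Matrix (Fin n) (Fin n) F // IsUnit A} × (Fin n → F)
  LocalInput := ((Fin n → F) × (Fin n → F)) × (Fin n → F)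
  LocalOutput := F
  localInput X l := (rowAndColumn X.1.1 l, X.2)
  Correct X out := Matrix.mulVec X.1.1 out = X.2

/-! ## The exponent of matrix multiplication -/

/-- There is a bilinear algebraic algorithm of rank `t` for the product of two `m × m` matrices
over `F`, given by its coefficients `α`, `γ`, `lam`. -/
def HasMatMulAlgorithm (F : Type u) [Field F] (m t : ℕ) : Prop :=
  ∃ α γ lam : Fin m → Fin m → Fin t → F, ∀ (A B : Matrix (Fin m) (Fin m) F) (i j : Fin m),
    (A * B) i j = ∑ μ, lam i j μ *
      (∑ i', ∑ j', α i' j' μ * A i' j') * (∑ i', ∑ j', γ i' j' μ * B j' i')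

/-- Uniformly over the fields `F i`, products of `m × m` matrices can be computed by algebraic
algorithms of rank `O(m ^ τ)`. -/
def MatMulRankO {ι : Type v} (F : ι → Type u) [∀ i, Field (F i)] (τ : ℝ) : Prop :=
  ∃ C : ℝ, ∀ (i : ι) (m : ℕ), 1 ≤ m →
    ∃ t : ℕ, (t : ℝ) ≤ C * (m : ℝ) ^ τ ∧ HasMatMulAlgorithm (F i) m t

/-- The exponent `ω` of matrix multiplication over the fields `F i`: the minimal `τ` such that
rank `O(m ^ (τ + ε))` is possible for every `ε > 0`. -/
noncomputable def matMulExponent {ι : Type v} (F : ι → Type u) [∀ i, Field (F i)] : ℝ :=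
  sInf {τ : ℝ | ∀ ε : ℝ, 0 < ε → MatMulRankO F (τ + ε)}

/-- `c n² log n ≤ |F i| ≤ K n ^ k`, for a network with `n ≥ 1` nodes. -/
def FieldSizeAdmissible {ι : Type v} (F : ι → Type u) (c K : ℝ) (k : ℕ) (n : ℕ) (i : ι) : Prop :=
  1 ≤ n ∧ c * (n : ℝ) ^ 2 * Real.log n ≤ (Nat.card (F i) : ℝ) ∧
    (Nat.card (F i) : ℝ) ≤ K * (n : ℝ) ^ k

end CongestedClique

open CongestedClique

/-! The proof reduces all three problems to `O(log n)` matrix multiplications, in the manner of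
Wiedemann. Let `B = A U` with a random matrix `U`, and take vectors `u`, `v`, of which `u` is
random. The Hankel matrix `H_c` of the moments `uᵀ B^(i+j+c) v` factors as `L B^c R`, where `L` has
the rows `uᵀ B^i` and `R` the columns `B^j v` (`hankel_moment`). If `H_1` is invertible, then `det B
= det H_1 / det H_0`, and dividing by `det U`, found in the same way, gives `det A`. For `v = b`,
the vector `U R H_1⁻¹ L b` solves `A x = b`. In general `rank H_1 ≤ rank A`, with equality if the
leading minor of order `rank A` does not vanish.

Each of these minors is a polynomial of degree at most `3 n²` in the coins. It is not the zero
polynomial: `U` can be chosen so that `A U` permutes cyclically a basis of the image of `A`, and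
this turns the minor into the determinant of a permutation matrix (`exists_momentMinor_ne_zero`). By
Schwartz–Zippel the failure probability is `O(n² / |F|) = O(1 / log n)`.

Repeated squaring yields `2 n` Krylov vectors with `O(log n)` matrix products (`MulRounds.krylov`).
For one product, the matrices are cut into `d × d` blocks such that a bilinear algorithm for size
`d` has rank at most `n`. Each node then multiplies one pair of combined blocks with `O(n^(2-2/τ))`
entries, and moving these takes `O(n^(1-2/τ))` rounds (`mulRounds_of_algorithm`). The finitely many
`n` for which the probability bound exceeds `1/3` are handled by collecting the whole matrix. -/

namespace CongestedClique

/-! ### Functions of distributed data that can be computed in a given number of rounds -/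

/-- `Computable n β T f`: starting from local data `x l` at the nodes `l`, some `T` rounds of
communication and local computation leave node `l` with `f x l`. -/
def Computable (n β : ℕ) {S' : Type w} :
    ℕ → ∀ {S : Type u}, ((Fin n → S) → Fin n → S') → Prop
  | 0, S, f => ∃ g : Fin n → S → S', ∀ x l, f x l = g l (x l)
  | T + 1, S, f => ∃ (send : Fin n → S → Fin n → Message β n)
      (f' : (Fin n → S × (Fin n → Message β n)) → Fin n → S'), Computable n β T f' ∧
        ∀ x, f x = f' fun l => (x l, fun l' => send l' (x l') l)

namespace Computable

variable {n β : ℕ}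

lemma precomp_local {S : Type u} {S₁ : Type v} {S' : Type w} {T : ℕ}
    {f : (Fin n → S₁) → Fin n → S'} (hf : Computable n β T f) (g : Fin n → S → S₁) :
    Computable n β T fun x => f fun l => g l (x l) := by
  induction T generalizing S S₁ with
  | zero =>
    obtain ⟨h, hh⟩ := hf
    exact ⟨fun l s => h l (g l s), fun x l => hh _ l⟩
  | succ T ih =>
    obtain ⟨send, f', hf', h⟩ := hf
    exact ⟨fun l s => send l (g l s), _, ih hf' fun l p => (g l p.1, p.2), fun x => h _⟩

lemma comp {S : Type u} {S₁ : Type v} {S' : Type w} {T T₁ : ℕ}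
    {f : (Fin n → S) → Fin n → S₁} {g : (Fin n → S₁) → Fin n → S'}
    (hf : Computable n β T f) (hg : Computable n β T₁ g) :
    Computable n β (T₁ + T) fun x => g (f x) := by
  induction T generalizing S with
  | zero =>
    obtain ⟨h, hh⟩ := hf
    have h1 : (fun x => g (f x)) = fun x => g fun l => h l (x l) :=
      funext fun x => congrArg g (funext (hh x))
    rw [h1]
    exact precomp_local hg h
  | succ T ih =>
    obtain ⟨send, f', hf', h⟩ := hf
    exact ⟨send, _, ih hf', fun x => congrArg g (h x)⟩

lemma keep {S : Type u} {S' : Type w} {T : ℕ} {f : (Fin n → S) → Fin n → S'}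
    (hf : Computable n β T f) : Computable n β T fun x l => (x l, f x l) := by
  induction T generalizing S with
  | zero =>
    obtain ⟨h, hh⟩ := hf
    exact ⟨fun l s => (s, h l s), fun x l => by simp only [hh]⟩
  | succ T ih =>
    obtain ⟨send, f', hf', h⟩ := hf
    have h1 := comp (ih hf') (g := fun x l => ((x l).1.1, (x l).2)) (T₁ := 0)
      ⟨fun l p => (p.1.1, p.2), fun x l => rfl⟩
    rw [Nat.zero_add] at h1
    exact ⟨send, _, h1, fun x => by simp [h]⟩

lemma succ {S : Type u} {S' : Type w} {T : ℕ} {f : (Fin n → S) → Fin n → S'}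
    (hf : Computable n β T f) : Computable n β (T + 1) f :=
  ⟨fun _ _ _ _ => false, _, precomp_local hf fun _ p => p.1, fun _ => rfl⟩

/-- The messages that the nodes have received in the first `t` rounds, when the messages are
computed by `send` from the initial data and the messages received before. -/
def history {S : Type u}
    (send : Fin n → S → List (Fin n → Message β n) → Fin n → Message β n) (x : Fin n → S) :
    ℕ → Fin n → List (Fin n → Message β n)
  | 0 => fun _ => []
  | t + 1 => fun l => history send x t l ++ [fun l' => send l' (x l') (history send x t l') l]

/-- In `Computable` the type of the local data grows with every round, while a `Protocol` has a
single state type. The initial data with the list of received messages serves for all rounds. -/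
lemma exists_history {S : Type u} {S' : Type w} {T : ℕ} {f : (Fin n → S) → Fin n → S'}
    (hf : Computable n β T f) :
    ∃ (send : Fin n → S → List (Fin n → Message β n) → Fin n → Message β n)
      (out : Fin n → S → List (Fin n → Message β n) → S'),
      ∀ x l, f x l = out l (x l) (history send x T l) := by
  induction T generalizing S with
  | zero =>
    obtain ⟨h, hh⟩ := hf
    exact ⟨fun _ _ _ _ _ => false, fun l s _ => h l s, hh⟩
  | succ T ih =>
    obtain ⟨send, f', hf', h⟩ := hf
    obtain ⟨send', out', h'⟩ := ih hf'
    let send₁ : Fin n → S → List (Fin n → Message β n) → Fin n → Message β n :=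
      fun l s hist => match hist with
        | [] => send l s
        | m :: rest => send' l (s, m) rest
    let out₁ : Fin n → S → List (Fin n → Message β n) → S' :=
      fun l s hist => match hist with
        -- A dummy value: after `T + 1` rounds the history is not empty.
        | [] => out' l (s, fun _ _ => false) []
        | m :: rest => out' l (s, m) rest
    have key : ∀ x t l, history send₁ x (t + 1) l = (fun l' => send l' (x l') l) ::
        history send' (fun l => (x l, fun l' => send l' (x l') l)) t l := by
      intro x t
      induction t with
      | zero => intro l; rfl
      | succ t iht =>
        intro l
        change history send₁ x (t + 1) l ++
          [fun l' => send₁ l' (x l') (history send₁ x (t + 1) l') l] = _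
        simp only [iht]
        rfl
    refine ⟨send₁, out₁, fun x l => ?_⟩
    rw [key, h, h']

/-- A computable function of the local inputs and coins is the result of a protocol. -/
lemma exists_protocol (prob : Problem.{u, w} n) {Coin : Type u} [Finite Coin] [Nonempty Coin]
    {T : ℕ} {f : (Fin n → prob.LocalInput × Coin) → Fin n → prob.LocalOutput}
    (hf : Computable n β T f) :
    ∃ P : Protocol n β prob.LocalInput prob.LocalOutput, ∀ X, failureProb prob P T X =
      (Set.ncard {r : Fin n → Coin |
        ¬ prob.Correct X (f fun l => (prob.localInput X l, r l))} : ℝ) /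
          (Nat.card (Fin n → Coin) : ℝ) := by
  obtain ⟨send, out, h⟩ := hf.exists_history
  let P : Protocol n β prob.LocalInput prob.LocalOutput :=
    { Coin := Coin
      coin_finite := inferInstance
      coin_nonempty := inferInstance
      State := (prob.LocalInput × Coin) × List (Fin n → Message β n)
      init := fun _ i c => ((i, c), [])
      send := fun l s => send l s.1 s.2
      receive := fun _ s m => (s.1, s.2 ++ [m])
      output := fun l s => out l s.1 s.2 }
  have key : ∀ x (r : Fin n → Coin) t l, P.stateAfter x r t l =
      ((x l, r l), history send (fun l => (x l, r l)) t l) := by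
    intro x r t
    induction t with
    | zero => intro l; rfl
    | succ t iht =>
      intro l
      rw [Protocol.stateAfter]
      simp only [iht, history, P]
  have hrun : ∀ x (r : Fin n → Coin), P.run T x r = f fun l => (x l, r l) := fun x r =>
    funext fun l => (congrArg (fun s => P.output l s) (key x r T l)).trans
      (h (fun l => (x l, r l)) l).symm
  refine ⟨P, fun X => ?_⟩
  unfold failureProb
  simp only [← hrun]
  rfl

end Computable

/-- In `T` rounds the nodes can pass from the distributed data `X` to the distributed data `Y`,
where both are functions of a global situation `ω`, and `X ω l` is what node `l` knows. -/
def Reach {n : ℕ} (β : ℕ) {Ω : Type*} {S S' : Type*} (T : ℕ) (X : Ω → Fin n → S)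
    (Y : Ω → Fin n → S') : Prop :=
  ∃ f : (Fin n → S) → Fin n → S', Computable n β T f ∧ ∀ ω, Y ω = f (X ω)

namespace Reach

variable {n β : ℕ} {Ω S S₁ S₂ S₃ : Type*} {T T₁ T₂ : ℕ} {X : Ω → Fin n → S}
  {Y : Ω → Fin n → S₁} {Z : Ω → Fin n → S₂}

lemma of_local (g : Fin n → S → S₁) (h : ∀ ω l, Y ω l = g l (X ω l)) : Reach β 0 X Y :=
  ⟨fun x l => g l (x l), ⟨g, fun _ _ => rfl⟩, fun ω => funext (h ω)⟩

lemma trans (h₁ : Reach β T₁ X Y) (h₂ : Reach β T₂ Y Z) : Reach β (T₁ + T₂) X Z := by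
  obtain ⟨f, hf, hfX⟩ := h₁
  obtain ⟨g, hg, hgY⟩ := h₂
  refine ⟨_, add_comm T₂ T₁ ▸ hf.comp hg, fun ω => by rw [hgY, hfX]⟩

lemma map (h₁ : Reach β T X Y) (g : Fin n → S₁ → S₂) (h : ∀ ω l, Z ω l = g l (Y ω l)) :
    Reach β T X Z :=
  h₁.trans (of_local g h)

lemma comap (h₁ : Reach β T Y Z) (g : Fin n → S → S₁) (h : ∀ ω l, Y ω l = g l (X ω l)) :
    Reach β T X Z := by
  simpa using (of_local (β := β) g h).trans h₁

lemma keep (h : Reach β T X Y) : Reach β T X fun ω l => (X ω l, Y ω l) := by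
  obtain ⟨f, hf, hfX⟩ := h
  exact ⟨_, hf.keep, fun ω => by simp [hfX]⟩

lemma mono (h : Reach β T X Y) (hT : T ≤ T₁) : Reach β T₁ X Y := by
  obtain ⟨f, hf, hfX⟩ := h
  refine ⟨f, ?_, hfX⟩
  induction hT with
  | refl => exact hf
  | step _ ih => exact ih.succ

lemma prod (h₁ : Reach β T₁ X Y) (h₂ : Reach β T₂ X Z) :
    Reach β (T₁ + T₂) X fun ω l => (Y ω l, Z ω l) := by
  have h3 : Reach β T₂ (fun ω l => (X ω l, Y ω l)) Z := h₂.comap (fun _ p => p.1) fun _ _ => rfl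
  exact (h₁.keep.trans h3.keep).map (fun _ p => (p.1.2, p.2)) fun _ _ => rfl

/-- The computations run one after another, each from the retained data `X`. -/
lemma pi {k : ℕ} {Y : Fin k → Ω → Fin n → S₁} (h : ∀ i, Reach β T X (Y i)) :
    Reach β (k * T) X fun ω l i => Y i ω l := by
  induction k with
  | zero =>
    rw [Nat.zero_mul]
    exact of_local (fun _ _ i => i.elim0) fun ω l => funext fun i => i.elim0
  | succ k ih =>
    have h1 := (h 0).prod (ih fun i => h i.succ)
    refine (h1.mono (T₁ := (k + 1) * T) (by rw [Nat.succ_mul, add_comm])).map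
      (fun _ p => Fin.cons p.1 p.2) fun ω l => funext fun i => ?_
    refine Fin.cases ?_ (fun i => ?_) i <;> simp

lemma round (send : Fin n → S → Fin n → Message β n) :
    Reach β 1 X fun ω l l' => send l' (X ω l') l :=
  ⟨fun x l l' => send l' (x l') l,
    ⟨send, fun y l => (y l).2, ⟨fun _ p => p.2, fun _ _ => rfl⟩, fun _ => rfl⟩, fun _ => rfl⟩

/-- Every node sends to every node an element of a small set. -/
lemma exchange {V : Type*} [Finite V] [Nonempty V] {w : ℕ}
    (hV : Nat.card V ≤ 2 ^ (β * Nat.clog 2 n * w)) (send : Fin n → S → Fin n → V) :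
    Reach β w X fun ω l l' => send l' (X ω l') l := by
  obtain ⟨e⟩ : Nonempty (V ↪ (Fin w → Message β n)) := by
    have := Fintype.ofFinite V
    apply Function.Embedding.nonempty_of_card_le
    rw [Nat.card_eq_fintype_card] at hV
    simpa [Message, pow_mul] using hV
  have h1 := pi (β := β) (T := 1) (k := w) (X := X) fun i => round fun l s l' => e (send l s l') i
  rw [mul_one] at h1
  exact h1.map (fun _ p l' => Function.invFun e fun i => p i l')
    fun ω l => funext fun l' => (Function.leftInverse_invFun e.injective _).symm

end Reach


/-! ### Routing -/

/-- Messages with sources and destinations can be coloured so that messages with the same source,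
and messages with the same destination, have different colours. -/
lemma exists_coloring {J A B C : Type*} [Fintype J] [DecidableEq A] [DecidableEq B] [Fintype C]
    (src : J → A) (dst : J → B) {k : ℕ} (hC : 2 * k ≤ Fintype.card C)
    (hsrc : ∀ a, (Finset.univ.filter fun j => src j = a).card ≤ k)
    (hdst : ∀ b, (Finset.univ.filter fun j => dst j = b).card ≤ k) :
    ∃ col : J → C, ∀ j j', (src j = src j' ∨ dst j = dst j') → col j = col j' → j = j' := by
  classical
  suffices h : ∀ s : Finset J, ∃ col : J → C, ∀ j ∈ s, ∀ j' ∈ s,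
      (src j = src j' ∨ dst j = dst j') → col j = col j' → j = j' by
    obtain ⟨col, h⟩ := h Finset.univ
    exact ⟨col, fun j j' => h j (Finset.mem_univ _) j' (Finset.mem_univ _)⟩
  intro s
  induction s using Finset.induction_on with
  | empty =>
    rcases isEmpty_or_nonempty J with hJ | ⟨⟨j⟩⟩
    · exact ⟨fun j => hJ.elim j, by simp⟩
    · have h1 : 0 < (Finset.univ.filter fun i => src i = src j).card :=
        Finset.card_pos.2 ⟨j, by simp⟩
      have h2 := hsrc (src j)
      have : Nonempty C := Fintype.card_pos_iff.1 (by omega)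
      exact ⟨fun _ => Classical.arbitrary C, by simp⟩
  | insert j₀ s hj₀ ih =>
    obtain ⟨col, h⟩ := ih
    set U : Finset J := (Finset.univ.filter fun j => src j = src j₀) ∪
      (Finset.univ.filter fun j => dst j = dst j₀) with hU
    have hU1 : U.card ≤ 2 * k := by
      have := Finset.card_union_le (Finset.univ.filter fun j => src j = src j₀)
        (Finset.univ.filter fun j => dst j = dst j₀)
      have h1 := hsrc (src j₀)
      have h2 := hdst (dst j₀)
      rw [hU]
      omega
    -- Since `U` contains `j₀` itself, fewer than `2 * k` colours are forbidden, and the greedy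
    -- choice succeeds.
    have hmem : j₀ ∈ U := by simp [hU]
    have hcard : ((U.erase j₀).image col).card < Fintype.card C := by
      have h1 := Finset.card_erase_lt_of_mem hmem
      have h2 := Finset.card_image_le (s := U.erase j₀) (f := col)
      omega
    obtain ⟨c, -, hc⟩ := Finset.exists_mem_notMem_of_card_lt_card
      (show ((U.erase j₀).image col).card < (Finset.univ : Finset C).card from hcard)
    have hc' : ∀ j ∈ s, (src j = src j₀ ∨ dst j = dst j₀) → col j ≠ c := by
      rintro j hj hor rfl
      refine hc (Finset.mem_image_of_mem _ (Finset.mem_erase.2 ⟨?_, ?_⟩))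
      · rintro rfl
        exact hj₀ hj
      · simpa [hU] using hor
    have hne : ∀ j ∈ s, j ≠ j₀ := by
      rintro j hj rfl
      exact hj₀ hj
    refine ⟨Function.update col j₀ c, fun j hj j' hj' hor heq => ?_⟩
    rcases Finset.mem_insert.1 hj with hjj | hj <;> rcases Finset.mem_insert.1 hj' with hjj' | hj'
    · rw [hjj, hjj']
    · rw [hjj, Function.update_self, Function.update_of_ne (hne _ hj')] at heq
      exact absurd heq.symm
        (hc' _ hj' (hor.imp (fun h => by rw [← h, hjj]) fun h => by rw [← h, hjj]))
    · rw [hjj', Function.update_self, Function.update_of_ne (hne _ hj)] at heq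
      exact absurd heq (hc' _ hj (hjj' ▸ hor))
    · rw [Function.update_of_ne (hne _ hj), Function.update_of_ne (hne _ hj')] at heq
      exact h j hj j' hj' hor heq

/-- The part of the data `val` that is stored at the node `l`, when the entry `j` is stored at the
node `o j`; the other entries are replaced by zero. -/
def owned {n : ℕ} {J F : Type*} [Zero F] (o : J → Fin n) (val : J → F) (l : Fin n) (j : J) : F :=
  if o j = l then val j else 0

namespace Reach

variable {n β w : ℕ} {Ω J F : Type*} [Field F] [Finite F]

/-- `κ` assigns time slots of `w` rounds. In one slot a node has at most one entry for each
destination, so the sum that forms the message has at most one nonzero term. -/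
lemma relay [Fintype J] (hF : Nat.card F ≤ 2 ^ (β * Nat.clog 2 n * w)) {src dst : J → Fin n}
    {q : ℕ} (κ : J → Fin q)
    (hκ : ∀ j j', src j = src j' → dst j = dst j' → κ j = κ j' → j = j') (val : Ω → J → F) :
    Reach β (q * w) (fun ω => owned src (val ω)) (fun ω => owned dst (val ω)) := by
  classical
  have h1 := pi (β := β) fun i : Fin q => exchange (X := fun ω => owned src (val ω)) hF
    fun _ s l' => ∑ j, if dst j = l' ∧ κ j = i then s j else 0
  refine h1.map (fun l p j => if dst j = l then p (κ j) (src j) else 0) fun ω l => ?_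
  funext j
  unfold owned
  split_ifs with h
  · beta_reduce
    rw [Finset.sum_eq_single j]
    · simp [h]
    · intro j' _ hj'
      split_ifs with h2 h3
      · exact absurd (hκ j' j h3 (h2.1.trans h.symm) h2.2) hj'
      all_goals rfl
    · simp
  · rfl

/-- Data of which every node stores at most `n * q` entries before and after can be rearranged in
`O(q)` rounds. -/
lemma route [Fintype J] (hF : Nat.card F ≤ 2 ^ (β * Nat.clog 2 n * w)) {src dst : J → Fin n}
    {q : ℕ} (hsrc : ∀ l, (Finset.univ.filter fun j => src j = l).card ≤ n * q)
    (hdst : ∀ l, (Finset.univ.filter fun j => dst j = l).card ≤ n * q) (val : Ω → J → F) :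
    Reach β (4 * q * w) (fun ω => owned src (val ω)) (fun ω => owned dst (val ω)) := by
  -- A colour is an intermediate node together with a time slot. The colouring makes both hops, to
  -- the intermediate node and from there to the destination, free of collisions.
  obtain ⟨col, hcol⟩ := exists_coloring (C := Fin n × Fin (2 * q)) src dst (k := n * q)
    (by simp; apply le_of_eq; ring) hsrc hdst
  have h1 := relay hF (src := src) (dst := fun j => (col j).1) (fun j => (col j).2)
    (fun j j' h h' h'' => hcol j j' (Or.inl h) (Prod.ext h' h'')) val
  have h2 := relay hF (src := fun j => (col j).1) (dst := dst) (fun j => (col j).2)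
    (fun j j' h h' h'' => hcol j j' (Or.inr h') (Prod.ext h h'')) val
  exact (h1.trans h2).mono (le_of_eq (by ring))

/-- Every node learns one field element of every node. -/
lemma broadcast (hF : Nat.card F ≤ 2 ^ (β * Nat.clog 2 n * w)) (a : Ω → Fin n → F) :
    Reach β w a fun ω _ => a ω :=
  exchange hF fun _ s _ => s

/-- Every node learns the sums over all nodes of `n` quantities. -/
lemma sum_all (hF : Nat.card F ≤ 2 ^ (β * Nat.clog 2 n * w)) (a : Ω → Fin n → Fin n → F) :
    Reach β (2 * w) a fun ω _ j => ∑ l, a ω l j := by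
  have h1 : Reach β w a fun ω l l' => a ω l' l := 
    exchange hF fun _ (s : Fin n → F) l' => s l'
  have h2 : Reach β w a fun ω j => ∑ l, a ω l j := h1.map (fun _ p => ∑ l, p l) fun _ _ => rfl
  exact (h2.trans (broadcast hF _)).mono (by omega)

end Reach

/-! ### Distributed matrix multiplication -/

/-- When every node knows one row of each of two `n × n` matrices, then the rows of the product
can be computed in `M` rounds. -/
def MulRounds (n β : ℕ) (F : Type u) [Field F] (M : ℕ) : Prop :=
  ∀ {Ω : Type u} (A B : Ω → Matrix (Fin n) (Fin n) F),
    Reach β M (fun ω l => ((fun m => A ω l m, fun m => B ω l m) : (Fin n → F) × (Fin n → F)))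
      fun ω l m => (A ω * B ω) l m

/-- The identity between the coefficients of an algebraic algorithm for matrix multiplication. -/
lemma HasMatMulAlgorithm.exists_tensor {F : Type u} [Field F] {m t : ℕ}
    (h : HasMatMulAlgorithm F m t) : ∃ α γ lam : Fin m → Fin m → Fin t → F,
      ∀ i j a b c e, ∑ μ, lam i j μ * α a b μ * γ c e μ =
        if a = i ∧ b = e ∧ c = j then 1 else 0 := by
  obtain ⟨α, γ, lam, h⟩ := h
  refine ⟨α, γ, lam, fun i j a b c e => ?_⟩
  have h1 := h (Matrix.single a b 1) (Matrix.single e c 1) i j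
  have h2 : ∀ (f : Fin m → Fin m → F) (x y : Fin m),
      ∑ i', ∑ j', f i' j' * (Matrix.single x y (1 : F)) i' j' = f x y := by
    intro f x y
    rw [Finset.sum_eq_single x _ (by simp), Finset.sum_eq_single y _ (by simp)]
    · simp
    · intro y' _ hy'
      simp [hy'.symm]
    · intro x' _ hx'
      simp [hx'.symm]
  have h3 : ∀ (f : Fin m → Fin m → F) (x y : Fin m),
      ∑ i', ∑ j', f i' j' * (Matrix.single x y (1 : F)) j' i' = f y x := by
    intro f x y
    rw [Finset.sum_comm]
    exact h2 (fun i j => f j i) x y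
  simp only [h2, h3] at h1
  rw [← h1]
  by_cases hbe : b = e
  · subst hbe
    rw [Matrix.single_mul_single_same, Matrix.single_apply]
    simp
  · rw [Matrix.single_mul_single_of_ne _ _ _ _ hbe]
    simp [hbe]

lemma exists_balanced (X : Type*) [Fintype X] {n q : ℕ} (h : Fintype.card X ≤ n * q) :
    ∃ f : X → Fin n, ∀ l, (Finset.univ.filter fun x => f x = l).card ≤ q := by
  obtain ⟨e⟩ : Nonempty (X ↪ Fin n × Fin q) :=
    Function.Embedding.nonempty_of_card_le (by simpa using h)
  refine ⟨fun x => (e x).1, fun l => ?_⟩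
  calc _ ≤ (Finset.univ : Finset (Fin q)).card := by
        refine Finset.card_le_card_of_injOn (fun x => (e x).2) (by simp) fun x hx y hy hxy => ?_
        simp only [Finset.coe_filter, Finset.mem_univ, true_and, Set.mem_ofPred_eq] at hx hy
        exact e.injective (Prod.ext (hx.trans hy.symm) hxy)
    _ = q := by simp

section BlockMul

variable {F : Type u} [Field F] {n d s t : ℕ} (ρ : Fin n → Fin d × Fin s)

/-- A linear combination, with coefficients `α`, of the blocks of a matrix: the entry at a
position in the blocks. -/
def blockComb (α : Fin d → Fin d → F) (A : Fin n × Fin n → F) (p : Fin s × Fin s) : F :=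
  ∑ e : Fin n × Fin n, if ((ρ e.1).2, (ρ e.2).2) = p then α (ρ e.1).1 (ρ e.2).1 * A e else 0

/-- `ρ` splits an index into a block number and a position in the block; pairs that are not attained
act as padding by zeros. Expanding the products over pairs `e`, `f` of matrix entries, the positions
are matched by the block products and the block numbers by the tensor identity. Injectivity of `ρ`
turns this into equality of indices. -/
lemma sum_blockComb_mul (hρ : Function.Injective ρ) {α γ lam : Fin d → Fin d → Fin t → F}
    (h : ∀ i j a b c e, ∑ μ, lam i j μ * α a b μ * γ c e μ =
        if a = i ∧ b = e ∧ c = j then 1 else 0)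
    (A B : Matrix (Fin n) (Fin n) F) (l m : Fin n) :
    ∑ μ, lam (ρ l).1 (ρ m).1 μ * ∑ b, blockComb ρ (fun i j => α i j μ) (fun e => A e.1 e.2)
        ((ρ l).2, b) * blockComb ρ (fun i j => γ j i μ) (fun e => B e.1 e.2) (b, (ρ m).2) =
      (A * B) l m := by
  classical
  have h1 : ∀ μ b, blockComb ρ (fun i j => α i j μ) (fun e => A e.1 e.2) ((ρ l).2, b) *
      blockComb ρ (fun i j => γ j i μ) (fun e => B e.1 e.2) (b, (ρ m).2) =
      ∑ e : Fin n × Fin n, ∑ f : Fin n × Fin n,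
        (if (ρ e.2).2 = b then (if (ρ e.1).2 = (ρ l).2 ∧ (ρ f.1).2 = b ∧ (ρ f.2).2 = (ρ m).2 then
          α (ρ e.1).1 (ρ e.2).1 μ * γ (ρ f.2).1 (ρ f.1).1 μ * (A e.1 e.2 * B f.1 f.2) else 0)
          else 0) := by
    intro μ b
    unfold blockComb
    rw [Finset.sum_mul_sum]
    refine Finset.sum_congr rfl fun e _ => Finset.sum_congr rfl fun f _ => ?_
    simp only [Prod.mk.injEq]
    split_ifs <;> first | tauto | ring
  have h2 : ∀ μ, ∑ b, blockComb ρ (fun i j => α i j μ) (fun e => A e.1 e.2) ((ρ l).2, b) *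
      blockComb ρ (fun i j => γ j i μ) (fun e => B e.1 e.2) (b, (ρ m).2) =
      ∑ e : Fin n × Fin n, ∑ f : Fin n × Fin n,
        if (ρ e.1).2 = (ρ l).2 ∧ (ρ f.1).2 = (ρ e.2).2 ∧ (ρ f.2).2 = (ρ m).2 then
          α (ρ e.1).1 (ρ e.2).1 μ * γ (ρ f.2).1 (ρ f.1).1 μ * (A e.1 e.2 * B f.1 f.2) else 0 := by
    intro μ
    simp only [h1]
    rw [Finset.sum_comm]
    refine Finset.sum_congr rfl fun e _ => ?_
    rw [Finset.sum_comm]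
    refine Finset.sum_congr rfl fun f _ => ?_
    rw [Finset.sum_ite_eq]
    simp
  simp only [h2, Finset.mul_sum]
  rw [Finset.sum_comm]
  have h3 : ∀ e : Fin n × Fin n, ∑ μ, ∑ f : Fin n × Fin n, lam (ρ l).1 (ρ m).1 μ *
      (if (ρ e.1).2 = (ρ l).2 ∧ (ρ f.1).2 = (ρ e.2).2 ∧ (ρ f.2).2 = (ρ m).2 then
        α (ρ e.1).1 (ρ e.2).1 μ * γ (ρ f.2).1 (ρ f.1).1 μ * (A e.1 e.2 * B f.1 f.2) else 0) =
      ∑ f : Fin n × Fin n, if e.1 = l ∧ f.1 = e.2 ∧ f.2 = m then A e.1 e.2 * B f.1 f.2 else 0 := by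
    intro e
    rw [Finset.sum_comm]
    refine Finset.sum_congr rfl fun f _ => ?_
    have h4 : ∀ x y, x = y ↔ (ρ x).1 = (ρ y).1 ∧ (ρ x).2 = (ρ y).2 := fun x y => by
      rw [← Prod.ext_iff, hρ.eq_iff]
    by_cases hc : (ρ e.1).2 = (ρ l).2 ∧ (ρ f.1).2 = (ρ e.2).2 ∧ (ρ f.2).2 = (ρ m).2
    · simp only [hc, and_self, if_true]
      have h5 := h (ρ l).1 (ρ m).1 (ρ e.1).1 (ρ e.2).1 (ρ f.2).1 (ρ f.1).1
      have h6 : (e.1 = l ∧ f.1 = e.2 ∧ f.2 = m) ↔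
          ((ρ e.1).1 = (ρ l).1 ∧ (ρ e.2).1 = (ρ f.1).1 ∧ (ρ f.2).1 = (ρ m).1) := by
        rw [h4 e.1, h4 f.1, h4 f.2]
        constructor
        · rintro ⟨⟨h1, -⟩, ⟨h2, -⟩, h3, -⟩
          exact ⟨h1, h2.symm, h3⟩
        · rintro ⟨h1, h2, h3⟩
          exact ⟨⟨h1, hc.1⟩, ⟨h2.symm, hc.2.1⟩, h3, hc.2.2⟩
      simp only [← mul_assoc, ← Finset.sum_mul, h6]
      rw [h5]
      split_ifs <;> ring
    · have h6 : ¬ (e.1 = l ∧ f.1 = e.2 ∧ f.2 = m) := by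
        rintro ⟨h1, h2, h3⟩
        exact hc ⟨by rw [h1], by rw [h2], by rw [h3]⟩
      simp [hc, h6]
  simp only [h3]
  rw [Matrix.mul_apply, Fintype.sum_prod_type]
  simp only [Fintype.sum_prod_type]
  rw [Finset.sum_eq_single l _ (by simp)]
  · refine Finset.sum_congr rfl fun k _ => ?_
    rw [Finset.sum_eq_single k _ (by simp), Finset.sum_eq_single m _ (by simp)]
    · simp
    · intro m' _ hm'
      simp [hm']
    · intro k' _ hk'
      simp [hk']
  · intro l' _ hl'
    simp [hl']

end BlockMul

section MulRounds

variable {F : Type u} [Field F] [Finite F] {n β w d s t q : ℕ}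

/-- A row has only `n` entries; the factor `5` is the load that `route` has to allow at the other
end, where entries are stored by position. -/
lemma card_filter_fst_le (l : Fin n) :
    (Finset.univ.filter fun e : Fin n × Fin n => e.1 = l).card ≤ n * 5 := by
  calc _ ≤ (Finset.univ : Finset (Fin n)).card := by
        refine Finset.card_le_card_of_injOn Prod.snd (by simp) fun x hx y hy hxy => ?_
        simp only [Finset.coe_filter, Finset.mem_univ, true_and, Set.mem_ofPred_eq] at hx hy
        exact Prod.ext (hx.trans hy.symm) hxy
    _ ≤ n * 5 := by simp; omega

/-- The entries of all `d * d` blocks at one position are stored at the same node, which makes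
linear combinations of blocks a local computation. -/
lemma card_filter_position_le {ρ : Fin n → Fin d × Fin s} (hρ : Function.Injective ρ)
    {pos : Fin s × Fin s → Fin n} (hpos : ∀ l, (Finset.univ.filter fun p => pos p = l).card ≤ q)
    (hqd : q * (d * d) ≤ n * 5) (l : Fin n) :
    (Finset.univ.filter fun e : Fin n × Fin n => pos ((ρ e.1).2, (ρ e.2).2) = l).card ≤ n * 5 := by
  calc _ ≤ ((Finset.univ.filter fun p => pos p = l) ×ˢ
        (Finset.univ : Finset (Fin d × Fin d))).card := by
        refine Finset.card_le_card_of_injOn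
          (fun e => (((ρ e.1).2, (ρ e.2).2), ((ρ e.1).1, (ρ e.2).1))) ?_ fun x hx y hy hxy => ?_
        · intro e he
          simpa using he
        · simp only [Prod.mk.injEq] at hxy
          exact Prod.ext (hρ (Prod.ext hxy.2.1 hxy.1.1)) (hρ (Prod.ext hxy.2.2 hxy.1.2))
    _ ≤ q * (d * d) := by
        rw [Finset.card_product]
        exact Nat.mul_le_mul (hpos l) (by simp)
    _ ≤ n * 5 := hqd

lemma card_filter_pos_fst_le (ht : t ≤ n) {pos : Fin s × Fin s → Fin n}
    (hpos : ∀ l, (Finset.univ.filter fun p => pos p = l).card ≤ q) (l : Fin n) :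
    (Finset.univ.filter fun x : (Fin s × Fin s) × Fin t => pos x.1 = l).card ≤ n * q := by
  calc _ ≤ ((Finset.univ.filter fun p => pos p = l) ×ˢ (Finset.univ : Finset (Fin t))).card := by
        refine Finset.card_le_card fun x hx => ?_
        simpa using hx
    _ ≤ q * n := by
        rw [Finset.card_product]
        exact Nat.mul_le_mul (hpos l) (by simpa using ht)
    _ = n * q := mul_comm _ _

lemma card_filter_castLE_le (ht : t ≤ n) (hs : s * s ≤ n * q) (l : Fin n) :
    (Finset.univ.filter fun x : (Fin s × Fin s) × Fin t => Fin.castLE ht x.2 = l).card ≤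
      n * q := by
  calc _ ≤ (Finset.univ : Finset (Fin s × Fin s)).card := by
        refine Finset.card_le_card_of_injOn Prod.fst (by simp) fun x hx y hy hxy => ?_
        simp only [Finset.coe_filter, Finset.mem_univ, true_and, Set.mem_ofPred_eq] at hx hy
        exact Prod.ext hxy (Fin.castLE_injective ht (hx.trans hy.symm))
    _ ≤ n * q := by simpa using hs

/-- From the rows of a matrix, the nodes compute linear combinations of its blocks, one
combination for each node. -/
lemma Reach.blockComb (hF : Nat.card F ≤ 2 ^ (β * Nat.clog 2 n * w)) (ht : t ≤ n)
    (hs : s * s ≤ n * q) (hqd : q * (d * d) ≤ n * 5) {ρ : Fin n → Fin d × Fin s}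
    (hρ : Function.Injective ρ) {pos : Fin s × Fin s → Fin n}
    (hpos : ∀ l, (Finset.univ.filter fun p => pos p = l).card ≤ q)
    (α : Fin d → Fin d → Fin t → F) {Ω : Type*} (A : Ω → Matrix (Fin n) (Fin n) F) :
    Reach β (4 * 5 * w + 4 * q * w) (fun ω l m => A ω l m) fun ω =>
      owned (fun x : (Fin s × Fin s) × Fin t => Fin.castLE ht x.2) fun x =>
        blockComb ρ (fun i j => α i j x.2) (fun e => A ω e.1 e.2) x.1 := by
  classical
  -- Entries move to the node in charge of their position, all `t` combinations at that position are
  -- formed there, and the combination with number `μ` is sent to node `μ`.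
  have h1 := Reach.route hF (J := Fin n × Fin n) (fun l => card_filter_fst_le l)
    (card_filter_position_le hρ hpos hqd) (fun ω e => A ω e.1 e.2)
  have h2 := h1.comap (X := fun ω l m => A ω l m) (fun l r e => if e.1 = l then r e.2 else 0)
      fun ω l => by
    funext e
    unfold owned
    beta_reduce
    split_ifs with h
    · rw [h]
    · rfl
  have h3 := h2.map (Z := fun ω => owned (fun x : (Fin s × Fin s) × Fin t => pos x.1)
    fun x => CongestedClique.blockComb ρ (fun i j => α i j x.2) (fun e => A ω e.1 e.2) x.1)
    (fun l f x => if pos x.1 = l then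
      CongestedClique.blockComb ρ (fun i j => α i j x.2) f x.1 else 0) fun ω l => by
    funext x
    unfold owned CongestedClique.blockComb
    beta_reduce
    split_ifs with h
    · refine Finset.sum_congr rfl fun e _ => ?_
      split_ifs with h1 h2
      · rfl
      · rw [h1] at h2
        exact absurd h h2
      · rfl
    · rfl
  exact h3.trans (Reach.route hF (card_filter_pos_fst_le ht hpos)
    (card_filter_castLE_le ht hs) _)

/-- Node `μ` multiplies the two `s × s` matrices of the `μ`-th term of the algorithm. Each of `A`,
`B` and the product costs `20 * w` rounds between rows and positions and `4 * q * w` between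
positions and terms. -/
lemma mulRounds_of_algorithm (hF : Nat.card F ≤ 2 ^ (β * Nat.clog 2 n * w))
    (h : HasMatMulAlgorithm F d t) (ht : t ≤ n) (hds : n ≤ d * s) (hs : s * s ≤ n * q)
    (hqd : q * (d * d) ≤ n * 5) : MulRounds n β F ((60 + 12 * q) * w) := by
  classical
  intro Ω A B
  obtain ⟨α, γ, lam, h⟩ := h.exists_tensor
  obtain ⟨ρ, hρ⟩ : Nonempty (Fin n ↪ Fin d × Fin s) :=
    Function.Embedding.nonempty_of_card_le (by simpa using hds)
  obtain ⟨pos, hpos⟩ := exists_balanced (Fin s × Fin s) (n := n) (q := q) (by simpa using hs)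
  have hA := (Reach.blockComb hF ht hs hqd hρ hpos α A).comap
    (X := fun ω l => ((fun m => A ω l m, fun m => B ω l m) : (Fin n → F) × (Fin n → F)))
    (fun _ p => p.1) fun _ _ => rfl
  have hB := (Reach.blockComb hF ht hs hqd hρ hpos (fun i j => γ j i) B).comap
    (X := fun ω l => ((fun m => A ω l m, fun m => B ω l m) : (Fin n → F) × (Fin n → F)))
    (fun _ p => p.2) fun _ _ => rfl
  let P : Ω → (Fin s × Fin s) × Fin t → F := fun ω x => ∑ b,
    blockComb ρ (fun i j => α i j x.2) (fun e => A ω e.1 e.2) (x.1.1, b) *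
      blockComb ρ (fun i j => γ j i x.2) (fun e => B ω e.1 e.2) (b, x.1.2)
  have h1 := (hA.prod hB).map (Z := fun ω =>
    owned (fun x : (Fin s × Fin s) × Fin t => Fin.castLE ht x.2) (P ω))
    (fun _ p x => ∑ b, p.1 ((x.1.1, b), x.2) * p.2 ((b, x.1.2), x.2)) fun ω l => by
      funext x
      unfold owned
      beta_reduce
      by_cases h : Fin.castLE ht x.2 = l <;> simp [P, h]
  have h2 := h1.trans (Reach.route hF (card_filter_castLE_le ht hs)
    (card_filter_pos_fst_le ht hpos) _)
  have h3 := h2.map (Z := fun ω => owned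
      (fun e : Fin n × Fin n => pos ((ρ e.1).2, (ρ e.2).2)) fun e => (A ω * B ω) e.1 e.2)
    (fun l p e => if pos ((ρ e.1).2, (ρ e.2).2) = l then
      ∑ μ, lam (ρ e.1).1 (ρ e.2).1 μ * p (((ρ e.1).2, (ρ e.2).2), μ) else 0) fun ω l => by
    funext e
    unfold owned
    split_ifs with hl
    · exact (sum_blockComb_mul ρ hρ h (A ω) (B ω) e.1 e.2).symm
    · rfl
  have h4 := h3.trans (Reach.route hF (card_filter_position_le hρ hpos hqd)
    (fun l => card_filter_fst_le l) _)
  refine (h4.map (fun l p m => p (l, m)) fun ω l => ?_).mono (le_of_eq (by ring))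
  funext m
  simp [owned]

end MulRounds

/-! ### Ranks of algorithms for matrix multiplication -/

/-- The `t` linear forms on the left factor determine it: if all vanish at `A`, the algorithm gives
`A * 1 = 0`. -/
lemma HasMatMulAlgorithm.sq_le {F : Type u} [Field F] {m t : ℕ} (h : HasMatMulAlgorithm F m t) :
    m * m ≤ t := by
  obtain ⟨α, γ, lam, h⟩ := h
  let f : Matrix (Fin m) (Fin m) F →ₗ[F] (Fin t → F) :=
    { toFun := fun A μ => ∑ i', ∑ j', α i' j' μ * A i' j'
      map_add' := fun A B => by
        funext μ
        simp [mul_add, Finset.sum_add_distrib]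
      map_smul' := fun a A => by
        funext μ
        simp only [Matrix.smul_apply, smul_eq_mul, RingHom.id_apply, Pi.smul_apply,
          Finset.mul_sum]
        exact Finset.sum_congr rfl fun _ _ => Finset.sum_congr rfl fun _ _ => by ring }
  have hf : Function.Injective f := by
    rw [injective_iff_map_eq_zero]
    intro A hA
    ext i j
    have h1 := h A 1 i j
    have h2 : ∀ μ, ∑ i', ∑ j', α i' j' μ * A i' j' = 0 := fun μ => congrFun hA μ
    simpa [h2] using h1
  simpa [Module.finrank_matrix] using LinearMap.finrank_le_finrank_of_injective hf

lemma hasMatMulAlgorithm_cube (F : Type u) [Field F] (m : ℕ) :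
    HasMatMulAlgorithm F m (m * (m * m)) := by
  classical
  let e : Fin (m * (m * m)) ≃ Fin m × Fin m × Fin m :=
    finProdFinEquiv.symm.trans (Equiv.prodCongr (Equiv.refl _) finProdFinEquiv.symm)
  refine ⟨fun i j μ => if (e μ).1 = i ∧ (e μ).2.1 = j then 1 else 0,
    fun i j μ => if (e μ).2.1 = j ∧ (e μ).2.2 = i then 1 else 0,
    fun i j μ => if (e μ).1 = i ∧ (e μ).2.2 = j then 1 else 0, fun A B i j => ?_⟩
  rw [← e.symm.sum_comp]
  simp [Matrix.mul_apply, Fintype.sum_prod_type, ite_and]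

lemma hasMatMulAlgorithm_one (F : Type u) [Field F] : HasMatMulAlgorithm F 1 1 := by
  simpa using hasMatMulAlgorithm_cube F 1

section Exponent

variable {ι : Type v} {F : ι → Type u} [∀ i, Field (F i)]

lemma MatMulRankO.two_le [hι : Nonempty ι] {τ : ℝ} (h : MatMulRankO F τ) : 2 ≤ τ := by
  obtain ⟨C, h⟩ := h
  obtain ⟨i⟩ := hι
  by_contra! hτ
  have h1 : ∀ m : ℕ, 1 ≤ m → (m : ℝ) ^ (2 - τ) ≤ C := by
    intro m hm
    obtain ⟨t, ht, ha⟩ := h i m hm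
    have h2 : (m : ℝ) * m ≤ t := by exact_mod_cast ha.sq_le
    have hm0 : (0 : ℝ) < m := by exact_mod_cast hm
    rw [Real.rpow_sub hm0, div_le_iff₀ (Real.rpow_pos_of_pos hm0 _)]
    calc (m : ℝ) ^ (2 : ℝ) = m * m := by norm_cast; ring
      _ ≤ _ := h2.trans ht
  have h2 := (tendsto_rpow_atTop (sub_pos.2 hτ)).comp tendsto_natCast_atTop_atTop
  obtain ⟨m, hm, hm1⟩ := ((h2.eventually_gt_atTop C).and
    (Filter.eventually_ge_atTop 1)).exists
  exact absurd (h1 m hm1) (not_le.2 hm)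

lemma matMulRankO_three : MatMulRankO F 3 := by
  refine ⟨1, fun i m _ => ⟨_, le_of_eq ?_, hasMatMulAlgorithm_cube (F i) m⟩⟩
  norm_cast
  ring

lemma MatMulRankO.mono {τ τ' : ℝ} (h : MatMulRankO F τ) (hτ : τ ≤ τ') : MatMulRankO F τ' := by
  obtain ⟨C, h⟩ := h
  refine ⟨max C 0, fun i m hm => ?_⟩
  obtain ⟨t, ht, ha⟩ := h i m hm
  have hm1 : (1 : ℝ) ≤ m := by exact_mod_cast hm
  refine ⟨t, ht.trans ?_, ha⟩
  calc C * (m : ℝ) ^ τ ≤ max C 0 * (m : ℝ) ^ τ := by gcongr; exact le_max_left _ _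
    _ ≤ _ := by gcongr

/-- Exponents close to `ω` are achieved. -/
lemma exists_matMulRankO [Nonempty ι] {ε : ℝ} (hε : 0 < ε) :
    ∃ τ, MatMulRankO F τ ∧ 2 ≤ τ ∧ 1 - 2 / τ ≤ 1 - 2 / matMulExponent F + ε := by
  set S := {τ : ℝ | ∀ ε : ℝ, 0 < ε → MatMulRankO F (τ + ε)} with hS
  have hne : S.Nonempty := ⟨3, fun ε hε => matMulRankO_three.mono (by linarith)⟩
  have hlb : ∀ τ ∈ S, 2 ≤ τ := fun τ hτ => le_of_forall_pos_le_add fun ε hε => (hτ ε hε).two_le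
  have hω : 2 ≤ matMulExponent F := le_csInf hne hlb
  obtain ⟨τ, hτ, hlt⟩ := exists_lt_of_csInf_lt hne
    (show sInf S < matMulExponent F + ε from lt_add_of_pos_right _ hε)
  obtain ⟨δ, hδ, hδ'⟩ : ∃ δ, 0 < δ ∧ τ + δ ≤ matMulExponent F + ε :=
    ⟨matMulExponent F + ε - τ, by linarith, by linarith⟩
  -- The difference is `2ε / (ω (ω + ε))`, at most `ε` because `ω ≥ 2`.
  have h1 : 1 - 2 / (matMulExponent F + ε) ≤ 1 - 2 / matMulExponent F + ε := by
    have : 2 / matMulExponent F ≤ 2 / (matMulExponent F + ε) + ε := by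
      rw [div_add' _ _ _ (by linarith), div_le_div_iff₀ (by linarith) (by linarith)]
      nlinarith [mul_pos hε hε, mul_nonneg (sub_nonneg.2 hω) hε.le,
        mul_nonneg (mul_nonneg (sub_nonneg.2 hω) hε.le) hε.le,
        mul_nonneg (mul_nonneg (sub_nonneg.2 hω) hε.le) (sub_nonneg.2 hω)]
    linarith
  refine ⟨matMulExponent F + ε, (hτ δ hδ).mono hδ', by linarith, h1⟩

/-- For a network with `n` nodes, blocks can be chosen such that an algorithm of rank at most `n`
multiplies the block matrices, and the blocks have `O(n ^ (2 - 2 / τ))` entries. -/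
lemma MatMulRankO.exists_size {τ : ℝ} (h : MatMulRankO F τ) (hτ : 2 ≤ τ) :
    ∃ C : ℝ, 0 < C ∧ ∀ (i : ι) (n : ℕ), 1 ≤ n → ∃ d t : ℕ, HasMatMulAlgorithm (F i) d t ∧
      1 ≤ d ∧ t ≤ n ∧ (n : ℝ) ≤ C * (n : ℝ) ^ (1 - 2 / τ) * (d : ℝ) ^ 2 := by
  obtain ⟨C, h⟩ := h
  set C₁ := max C 1 with hC₁
  have hC1 : 1 ≤ C₁ := le_max_right _ _
  have hτ0 : 0 < τ := by linarith
  have hC0 : 0 < C₁ := by linarith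
  have hpow : 0 < C₁ ^ (2 / τ) := Real.rpow_pos_of_pos hC0 _
  have he : 0 ≤ 1 - 2 / τ := by rw [sub_nonneg, div_le_one hτ0]; exact hτ
  refine ⟨max (4 * C₁ ^ (2 / τ)) C₁, lt_max_of_lt_right hC0, fun i n hn => ?_⟩
  have hn0 : (0 : ℝ) < n := by exact_mod_cast hn
  have hn1 : (1 : ℝ) ≤ n := by exact_mod_cast hn
  rcases lt_or_ge (n : ℝ) C₁ with hlt | hge
  -- For `n < C₁` the trivial algorithm suffices, and the constant absorbs `n`.
  · refine ⟨1, 1, hasMatMulAlgorithm_one _, le_rfl, hn, ?_⟩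
    calc (n : ℝ) ≤ C₁ * 1 := by linarith
      _ ≤ max (4 * C₁ ^ (2 / τ)) C₁ * (n : ℝ) ^ (1 - 2 / τ) := by
        gcongr
        · exact le_max_right _ _
        · exact Real.one_le_rpow hn1 he
      _ = _ := by simp
  -- `y` solves `C₁ * y ^ τ = n`, so size `⌊y⌋₊` has rank at most `n`. Rounding down loses at most a
  -- factor `2`, hence the `4` in the constant.
  · set y := ((n : ℝ) / C₁) ^ (1 / τ) with hy
    have hq1 : 1 ≤ (n : ℝ) / C₁ := by rwa [le_div_iff₀ hC0, one_mul]
    have hy1 : 1 ≤ y := Real.one_le_rpow hq1 (by positivity)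
    have hfl : 1 ≤ ⌊y⌋₊ := Nat.one_le_floor_iff _ |>.2 hy1
    obtain ⟨t, ht, ha⟩ := h i ⌊y⌋₊ hfl
    have hfy : (⌊y⌋₊ : ℝ) ≤ y := Nat.floor_le (by linarith)
    have hfy2 : y ≤ 2 * (⌊y⌋₊ : ℝ) := by
      have h1 := Nat.lt_floor_add_one y
      have h2 : (1 : ℝ) ≤ ⌊y⌋₊ := by exact_mod_cast hfl
      linarith
    refine ⟨⌊y⌋₊, t, ha, hfl, ?_, ?_⟩
    · have h1 : (t : ℝ) ≤ n := calc
        (t : ℝ) ≤ C * (⌊y⌋₊ : ℝ) ^ τ := ht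
        _ ≤ C₁ * y ^ τ := by
          gcongr
          exact le_max_left _ _
        _ = n := by
          rw [hy, ← Real.rpow_mul (by positivity), one_div_mul_cancel hτ0.ne', Real.rpow_one]
          field_simp
      exact_mod_cast h1
    · have h1 : (n : ℝ) ^ (2 / τ) = C₁ ^ (2 / τ) * y ^ 2 := by
        rw [hy, ← Real.rpow_natCast, ← Real.rpow_mul (by positivity),
          Real.div_rpow hn0.le hC0.le]
        have : 1 / τ * ((2 : ℕ) : ℝ) = 2 / τ := by push_cast; ring
        rw [this]
        field_simp
      calc (n : ℝ) = (n : ℝ) ^ (1 - 2 / τ) * (n : ℝ) ^ (2 / τ) := by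
            rw [← Real.rpow_add hn0]
            simp
        _ ≤ (n : ℝ) ^ (1 - 2 / τ) * (C₁ ^ (2 / τ) * (2 * (⌊y⌋₊ : ℝ)) ^ 2) := by
            rw [h1]
            gcongr
        _ = 4 * C₁ ^ (2 / τ) * (n : ℝ) ^ (1 - 2 / τ) * (⌊y⌋₊ : ℝ) ^ 2 := by ring
        _ ≤ _ := by
            gcongr
            exact le_max_left _ _

/-- Matrix multiplication in `O(n ^ (1 - 2 / τ))` rounds. -/
lemma MatMulRankO.exists_mulRounds [∀ i, Finite (F i)] {τ : ℝ} (h : MatMulRankO F τ)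
    (hτ : 2 ≤ τ) (β w : ℕ) : ∃ C : ℝ, 0 < C ∧ ∀ (i : ι) (n : ℕ), 1 ≤ n →
      Nat.card (F i) ≤ 2 ^ (β * Nat.clog 2 n * w) →
      ∃ M : ℕ, w ≤ M ∧ (M : ℝ) ≤ C * (n : ℝ) ^ (1 - 2 / τ) ∧ MulRounds n β (F i) M := by
  obtain ⟨C, hC, h⟩ := h.exists_size hτ
  -- `360 = 72 * 5`, from `60 + 12 * q ≤ 72 * q` and `q ≤ 5 * C * n ^ (1 - 2 / τ)`; `w + 1` keeps
  -- the constant positive for `w = 0`.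
  refine ⟨360 * C * (w + 1), by positivity, fun i n hn hF => ?_⟩
  obtain ⟨d, t, ha, hd, ht, hn'⟩ := h i n hn
  have hdt := ha.sq_le
  obtain ⟨s, hs1, hs2⟩ : ∃ s, n ≤ d * s ∧ d * s ≤ 2 * n := by
    refine ⟨(n + d - 1) / d, ?_, ?_⟩
    · have h1 := Nat.div_add_mod (n + d - 1) d
      have h2 := Nat.mod_lt (n + d - 1) (show 0 < d by omega)
      omega
    · have h1 := Nat.mul_div_le (n + d - 1) d
      have h2 : d ≤ n := by nlinarith
      omega
  obtain ⟨q, hq1, hq2⟩ : ∃ q, s * s ≤ n * q ∧ n * q ≤ s * s + n := by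
    refine ⟨(s * s + n - 1) / n, ?_, ?_⟩
    · have h1 := Nat.div_add_mod (s * s + n - 1) n
      have h2 := Nat.mod_lt (s * s + n - 1) (show 0 < n by omega)
      omega
    · have h1 := Nat.mul_div_le (s * s + n - 1) n
      omega
  have hq0 : 1 ≤ q := by
    rcases Nat.eq_zero_or_pos q with rfl | hq
    · have : s = 0 := by nlinarith
      subst this
      omega
    · exact hq
  -- `5 = 4 + 1`: from `d * s ≤ 2 * n`, and from `d * d ≤ t ≤ n` for the rounding in `q`.
  have hqd : q * (d * d) ≤ n * 5 := by
    have h1 : n * (q * (d * d)) ≤ n * (n * 5) := by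
      calc n * (q * (d * d)) = (n * q) * (d * d) := by ring
        _ ≤ (s * s + n) * (d * d) := by gcongr
        _ = (d * s) * (d * s) + n * (d * d) := by ring
        _ ≤ (2 * n) * (2 * n) + n * n := by
          gcongr
          omega
        _ = n * (n * 5) := by ring
    exact Nat.le_of_mul_le_mul_left h1 (by omega)
  refine ⟨(60 + 12 * q) * w, by nlinarith, ?_, mulRounds_of_algorithm hF ha ht hs1 hq1 hqd⟩
  have hd0 : (0 : ℝ) < (d : ℝ) ^ 2 := by positivity
  have hn0 : (0 : ℝ) < (n : ℝ) ^ (1 - 2 / τ) := Real.rpow_pos_of_pos (by exact_mod_cast hn) _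
  have hq3 : (q : ℝ) ≤ 5 * (C * (n : ℝ) ^ (1 - 2 / τ)) := by
    have h1 : (q : ℝ) * (d : ℝ) ^ 2 ≤ n * 5 := by
      rw [sq]
      exact_mod_cast hqd
    refine le_of_mul_le_mul_right (h1.trans ?_) hd0
    linarith
  have hq4 : (1 : ℝ) ≤ q := by exact_mod_cast hq0
  push_cast
  calc (60 + 12 * (q : ℝ)) * w ≤ (72 * q) * (w + 1) := by gcongr <;> linarith
    _ ≤ (72 * (5 * (C * (n : ℝ) ^ (1 - 2 / τ)))) * (w + 1) := by gcongr
    _ = _ := by ring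

end Exponent


/-! ### Krylov sequences -/

open Matrix

variable {F : Type u} [Field F] {n β w M : ℕ}

/-- The first `N` vectors of the Krylov sequence `v, B v, B² v, …`, continued with zeros. -/
def krylov (B : Matrix (Fin n) (Fin n) F) (v : Fin n → F) (N : ℕ) (l : Fin n) (j : ℕ) : F :=
  if j < N then (B ^ j *ᵥ v) l else 0

/-- The sequence `uᵀ v, uᵀ B v, uᵀ B² v, …`. -/
def moment {R : Type*} [CommRing R] (B : Matrix (Fin n) (Fin n) R) (u v : Fin n → R)
    (j : ℕ) : R :=
  u ⬝ᵥ (B ^ j *ᵥ v)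

/-- The Hankel matrix of a sequence that is shifted by `c`. -/
def hankel {R : Type*} (n : ℕ) (s : ℕ → R) (c : ℕ) : Matrix (Fin n) (Fin n) R :=
  Matrix.of fun i j => s (i + j + c)

/-- The leading minor of order `r` of the Hankel matrix of the moments `uᵀ B v, uᵀ B² v, …`. -/
def momentMinor {R : Type*} [CommRing R] {r : ℕ} (hr : r ≤ n) (B : Matrix (Fin n) (Fin n) R)
    (u v : Fin n → R) : R :=
  ((hankel n (moment B u v) 1).submatrix (Fin.castLE hr) (Fin.castLE hr)).det

/-- The next vectors are `B^(N+j) v = B^N (B^j v)`, so they come from multiplying `B^N` by the known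
ones. These are at most `2 n` columns, i.e. two square matrices; with the squaring of `B^N` this
makes three products. -/
lemma MulRounds.krylov_double (hM : MulRounds n β F M) {Ω : Type u}
    (B : Ω → Matrix (Fin n) (Fin n) F) (v : Ω → Fin n → F) (N : ℕ) :
    Reach β (3 * M)
      (fun ω l => ((fun m => (B ω ^ N) l m, krylov (B ω) (v ω) (min N (2 * n)) l) :
        (Fin n → F) × (ℕ → F)))
      (fun ω l => ((fun m => (B ω ^ (2 * N)) l m,
        krylov (B ω) (v ω) (min (2 * N) (2 * n)) l) : (Fin n → F) × (ℕ → F))) := by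
  set X : Ω → Fin n → (Fin n → F) × (ℕ → F) := fun ω l =>
    (fun m => (B ω ^ N) l m, krylov (B ω) (v ω) (min N (2 * n)) l) with hX
  let W : Fin 2 → Ω → Matrix (Fin n) (Fin n) F := fun p ω =>
    Matrix.of fun l m => krylov (B ω) (v ω) (min N (2 * n)) l (p * n + m)
  have h1 := (hM (fun ω => B ω ^ N) (fun ω => B ω ^ N)).comap (X := X) (fun _ x => (x.1, x.1))
    fun _ _ => rfl
  have h2 : ∀ p, Reach β M X fun ω l m => (B ω ^ N * W p ω) l m := fun p =>
    (hM (fun ω => B ω ^ N) (W p)).comap (X := X) (fun _ x => (x.1, fun m => x.2 (p * n + m)))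
      fun _ _ => rfl
  have h3 := (h1.prod (Reach.pi h2)).keep
  refine (h3.map (fun l x => (x.2.1, fun j => if j < N then x.1.2 j else
    if h : j < min (2 * N) (2 * n) ∧ (j - N) / n < 2 ∧ (j - N) % n < n then
      x.2.2 ⟨(j - N) / n, h.2.1⟩ ⟨(j - N) % n, h.2.2⟩ else 0)) fun ω l => ?_).mono (by omega)
  have hn : 0 < n := l.pos
  refine Prod.ext ?_ ?_
  · funext m
    simp only [two_mul, pow_add]
  · funext j
    dsimp only [X]
    split_ifs with hj h
    · unfold krylov
      have : j < min N (2 * n) ↔ j < min (2 * N) (2 * n) := by omega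
      simp only [this]
    · rw [Matrix.mul_apply]
      have hd := Nat.div_add_mod (j - N) n
      have h4 : ∀ x, W ⟨(j - N) / n, h.2.1⟩ ω x ⟨(j - N) % n, h.2.2⟩ =
          (B ω ^ (j - N) *ᵥ v ω) x := by
        intro x
        simp only [W, Matrix.of_apply, krylov]
        rw [show (j - N) / n * n + (j - N) % n = j - N by rw [mul_comm]; exact hd,
          if_pos (by omega)]
      simp only [h4]
      rw [krylov, if_pos h.1]
      conv_lhs => rw [show j = N + (j - N) by omega, pow_add, ← Matrix.mulVec_mulVec]
      rfl
    · rw [krylov, if_neg]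
      intro hj'
      refine h ⟨hj', ?_, Nat.mod_lt _ hn⟩
      rw [Nat.div_lt_iff_lt_mul hn]
      omega

lemma MulRounds.krylov (hM : MulRounds n β F M) {Ω : Type u}
    (B : Ω → Matrix (Fin n) (Fin n) F) (v : Ω → Fin n → F) (k : ℕ) :
    Reach β (k * (3 * M))
      (fun ω l => ((fun m => B ω l m, v ω l) : (Fin n → F) × F))
      (fun ω l => ((fun m => (B ω ^ (2 ^ k)) l m,
        krylov (B ω) (v ω) (min (2 ^ k) (2 * n)) l) : (Fin n → F) × (ℕ → F))) := by
  induction k with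
  | zero =>
    rw [Nat.zero_mul]
    refine Reach.of_local (fun l x => (x.1, fun j => if j = 0 then x.2 else 0)) fun ω l => ?_
    have hn : 0 < n := l.pos
    refine Prod.ext (by simp) (funext fun j => ?_)
    unfold CongestedClique.krylov
    have : j < min (2 ^ 0) (2 * n) ↔ j = 0 := by simp; omega
    simp only [this]
    split_ifs with hj
    · subst hj
      simp
    · rfl
  | succ k ih =>
    rw [Nat.succ_mul, pow_succ']
    exact ih.trans (hM.krylov_double B v (2 ^ k))

/-- The nodes compute the first `2 n` vectors of a Krylov sequence, and all nodes learn the first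
`2 n` moments. -/
lemma MulRounds.moments [Finite F] (hF : Nat.card F ≤ 2 ^ (β * Nat.clog 2 n * w))
    (hM : MulRounds n β F M) (hw : w ≤ M) (hn : 1 ≤ n) {Ω : Type u}
    (B : Ω → Matrix (Fin n) (Fin n) F) (u v : Ω → Fin n → F) :
    Reach β (7 * (Nat.clog 2 (2 * n) * M))
      (fun ω l => ((fun m => B ω l m, u ω l, v ω l) : (Fin n → F) × F × F))
      (fun ω l => ((CongestedClique.krylov (B ω) (v ω) (2 * n) l,
        fun j => if j < 2 * n then moment (B ω) (u ω) (v ω) j else 0) : (ℕ → F) × (ℕ → F))) := by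
  have h1 := (hM.krylov B v (Nat.clog 2 (2 * n))).comap
    (X := fun ω l => ((fun m => B ω l m, u ω l, v ω l) : (Fin n → F) × F × F))
    (fun _ x => (x.1, x.2.2)) fun _ _ => rfl
  have h2 : 2 * n ≤ 2 ^ Nat.clog 2 (2 * n) := Nat.le_pow_clog (by norm_num) _
  rw [min_eq_right h2] at h1
  have h3 := h1.keep.map (Z := fun ω l =>
      ((u ω l, CongestedClique.krylov (B ω) (v ω) (2 * n) l) : F × (ℕ → F)))
    (fun _ x => (x.1.2.1, x.2.2)) fun _ _ => rfl
  -- `Reach.sum_all` forms `n` sums at a time, so the `2 n` moments come in two batches. Their `4 *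
  -- w` rounds raise the factor from `3` to at most `7`.
  have h4 : ∀ p : Fin 2, Reach β (2 * w)
      (fun ω l => ((u ω l, CongestedClique.krylov (B ω) (v ω) (2 * n) l) : F × (ℕ → F)))
      fun ω _ (m : Fin n) =>
        ∑ l, u ω l * CongestedClique.krylov (B ω) (v ω) (2 * n) l (p * n + m) :=
    fun p => (Reach.sum_all hF fun ω l (m : Fin n) =>
      u ω l * CongestedClique.krylov (B ω) (v ω) (2 * n) l (p * n + m)).comap
        (fun _ (x : F × (ℕ → F)) (m : Fin n) => x.1 * x.2 (p * n + m)) fun _ _ => rfl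
  have hk : 1 ≤ Nat.clog 2 (2 * n) := Nat.clog_pos (by norm_num) (by omega)
  refine ((h3.trans (Reach.pi h4).keep).map (fun l x => (x.1.2, fun j =>
    if h : j < 2 * n ∧ j / n < 2 ∧ j % n < n then x.2 ⟨j / n, h.2.1⟩ ⟨j % n, h.2.2⟩ else 0))
      fun ω l => ?_).mono (by nlinarith)
  refine Prod.ext rfl (funext fun j => ?_)
  dsimp only
  split_ifs with hj h h
  · have hd := Nat.div_add_mod j n
    rw [show j / n * n + j % n = j by rw [mul_comm]; exact hd]
    simp only [CongestedClique.krylov, if_pos hj]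
    rfl
  · exact absurd ⟨hj, (Nat.div_lt_iff_lt_mul (by omega)).2 hj, Nat.mod_lt _ (by omega)⟩ h
  · exact absurd h.1 hj
  · rfl

/-- The nodes compute the Krylov sequence and the moments of the product `A * U`. -/
lemma MulRounds.moments_mul [Finite F] (hF : Nat.card F ≤ 2 ^ (β * Nat.clog 2 n * w))
    (hM : MulRounds n β F M) (hw : w ≤ M) (hn : 1 ≤ n) {Ω : Type u}
    (A U : Ω → Matrix (Fin n) (Fin n) F) (u v : Ω → Fin n → F) :
    Reach β (8 * (Nat.clog 2 (2 * n) * M))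
      (fun ω l => ((fun m => A ω l m, fun m => U ω l m, u ω l, v ω l) :
        (Fin n → F) × (Fin n → F) × F × F))
      (fun ω l => ((CongestedClique.krylov (A ω * U ω) (v ω) (2 * n) l,
        fun j => if j < 2 * n then moment (A ω * U ω) (u ω) (v ω) j else 0) :
          (ℕ → F) × (ℕ → F))) := by
  have h1 := (hM A U).comap (X := fun ω l => ((fun m => A ω l m, fun m => U ω l m, u ω l, v ω l) :
    (Fin n → F) × (Fin n → F) × F × F)) (fun _ x => (x.1, x.2.1)) fun _ _ => rfl
  have h2 := h1.keep.map (Z := fun ω l =>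
    ((fun m => (A ω * U ω) l m, u ω l, v ω l) : (Fin n → F) × F × F))
    (fun _ x => (x.2, x.1.2.2)) fun _ _ => rfl
  have hk : 1 ≤ Nat.clog 2 (2 * n) := Nat.clog_pos (by norm_num) (by omega)
  exact (h2.trans (hM.moments hF hw hn _ u v)).mono (by nlinarith)

/-! ### Linear algebra with the Hankel matrices of moments -/

/-- The largest index is `(n - 1) + (n - 1) + c ≤ 2 * n - 1`; this is why `2 n` moments suffice. -/
lemma hankel_truncate (s : ℕ → F) {c : ℕ} (hc : c ≤ 1) :
    hankel n (fun j => if j < 2 * n then s j else 0) c = hankel n s c := by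
  ext i j
  simp only [hankel, Matrix.of_apply]
  rw [if_pos (by omega)]

/-- The matrix with the rows `uᵀ, uᵀ B, uᵀ B², …`. -/
def krylovRows (B : Matrix (Fin n) (Fin n) F) (u : Fin n → F) : Matrix (Fin n) (Fin n) F :=
  Matrix.of fun i => u ᵥ* B ^ (i : ℕ)

/-- The matrix with the columns `v, B v, B² v, …`. -/
def krylovCols (B : Matrix (Fin n) (Fin n) F) (v : Fin n → F) : Matrix (Fin n) (Fin n) F :=
  Matrix.of fun l j => (B ^ (j : ℕ) *ᵥ v) l

lemma krylovRows_mulVec (B : Matrix (Fin n) (Fin n) F) (u v : Fin n → F) :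
    krylovRows B u *ᵥ v = fun i : Fin n => moment B u v i := by
  funext i
  exact (Matrix.dotProduct_mulVec u (B ^ (i : ℕ)) v).symm

lemma hankel_moment (B : Matrix (Fin n) (Fin n) F) (u v : Fin n → F) (c : ℕ) :
    hankel n (moment B u v) c = krylovRows B u * B ^ c * krylovCols B v := by
  ext i j
  have h1 : (krylovRows B u * B ^ c * krylovCols B v) i j =
      (u ᵥ* B ^ (i : ℕ) ᵥ* B ^ c) ⬝ᵥ (B ^ (j : ℕ) *ᵥ v) := rfl
  rw [h1, ← Matrix.dotProduct_mulVec, ← Matrix.dotProduct_mulVec, Matrix.mulVec_mulVec,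
    Matrix.mulVec_mulVec, ← pow_add, ← pow_add]
  simp only [hankel, moment, Matrix.of_apply]
  congr 3
  ring

/-- This is `det (L B R) / det (L R)`. For singular `B` the numerator vanishes, so the quotient is
`0` whatever the denominator is, and no condition on `u`, `v` is needed. -/
lemma det_hankel_div {B : Matrix (Fin n) (Fin n) F} {u v : Fin n → F}
    (h : B.det ≠ 0 → (hankel n (moment B u v) 1).det ≠ 0) :
    (hankel n (moment B u v) 1).det / (hankel n (moment B u v) 0).det = B.det := by
  have h0 := hankel_moment B u v 0
  have h1 := hankel_moment B u v 1
  rw [pow_zero, mul_one] at h0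
  rw [pow_one] at h1
  by_cases hB : B.det = 0
  · rw [h1, Matrix.det_mul, Matrix.det_mul, hB]
    simp
  · have h2 := h hB
    rw [h1, Matrix.det_mul, Matrix.det_mul] at h2 ⊢
    rw [h0, Matrix.det_mul]
    have h3 : (krylovRows B u).det ≠ 0 := fun h => h2 (by rw [h]; ring)
    have h4 : (krylovCols B v).det ≠ 0 := fun h => h2 (by rw [h]; ring)
    field_simp

/-- The factorization `L A U R` bounds the rank from above, the nonzero minor of order `r` from
below. -/
lemma rank_hankel_eq {A U : Matrix (Fin n) (Fin n) F} {u v : Fin n → F} {r : ℕ} (hr : r = A.rank)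
    (hrn : r ≤ n) (h : momentMinor hrn (A * U) u v ≠ 0) :
    (hankel n (moment (A * U) u v) 1).rank = A.rank := by
  apply le_antisymm
  · rw [hankel_moment, pow_one]
    exact (Matrix.rank_mul_le_left _ _).trans ((Matrix.rank_mul_le_right _ _).trans
      (Matrix.rank_mul_le_left _ _))
  · have h1 : ((hankel n (moment (A * U) u v) 1).submatrix (Fin.castLE hrn)
      (Fin.castLE hrn)).rank = r := by
      rw [Matrix.rank_of_isUnit _ ((Matrix.isUnit_iff_isUnit_det _).2 (isUnit_iff_ne_zero.2 h)),
        Fintype.card_fin]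
    rw [← hr, ← h1]
    exact Matrix.rank_submatrix_le _ _ _

/-- Wiedemann's solution of a linear system. -/
lemma mulVec_krylovCols_eq {B : Matrix (Fin n) (Fin n) F} {u b : Fin n → F}
    (h : b ≠ 0 → (hankel n (moment B u b) 1).det ≠ 0) :
    B *ᵥ (krylovCols B b *ᵥ ((hankel n (moment B u b) 1)⁻¹ *ᵥ fun i => moment B u b i)) = b := by
  by_cases hb : b = 0
  · subst hb
    have : krylovCols B 0 = 0 := by
      ext l j
      simp [krylovCols]
    simp [this]
  · have h2 := h hb
    set H := hankel n (moment B u b) 1 with hH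
    have h1 : H = krylovRows B u * B * krylovCols B b := by rw [hH, hankel_moment, pow_one]
    have hL : IsUnit (krylovRows B u).det := by
      rw [isUnit_iff_ne_zero]
      intro h
      rw [h1, Matrix.det_mul, Matrix.det_mul, h] at h2
      simp at h2
    have hL' : IsUnit (krylovRows B u) := (Matrix.isUnit_iff_isUnit_det _).2 hL
    -- After multiplication by the invertible `L` the claim reads `(L B R) H⁻¹ L b = L b`, and `L B
    -- R = H`.
    apply Matrix.mulVec_injective_of_isUnit hL'
    rw [Matrix.mulVec_mulVec, Matrix.mulVec_mulVec, ← h1, Matrix.mulVec_mulVec,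
      Matrix.mul_nonsing_inv _ (isUnit_iff_ne_zero.2 h2), Matrix.one_mulVec, krylovRows_mulVec]

/-! ### The minors of the Hankel matrices as polynomials -/

section Polynomial

variable {n r : ℕ}

lemma moment_map {R S : Type*} [CommRing R] [CommRing S] (f : R →+* S)
    (B : Matrix (Fin n) (Fin n) R) (u v : Fin n → R) (j : ℕ) :
    f (moment B u v j) = moment (B.map f) (f ∘ u) (f ∘ v) j := by
  have h : (B.map f) ^ j = (B ^ j).map f := by
    have := map_pow f.mapMatrix B j
    simpa [RingHom.mapMatrix_apply] using this.symm
  rw [moment, moment, h, RingHom.map_dotProduct]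
  congr 1
  funext i
  simp [Matrix.mulVec, dotProduct, map_sum]

lemma momentMinor_map {R S : Type*} [CommRing R] [CommRing S] (f : R →+* S) (hr : r ≤ n)
    (B : Matrix (Fin n) (Fin n) R) (u v : Fin n → R) :
    f (momentMinor hr B u v) = momentMinor hr (B.map f) (f ∘ u) (f ∘ v) := by
  rw [momentMinor, RingHom.map_det]
  congr 1
  ext i j
  simp [hankel, moment_map]

open MvPolynomial

variable {σ : Type*} {F : Type*} [Field F]

lemma totalDegree_dotProduct_le {u v : Fin n → MvPolynomial σ F} {a b : ℕ}
    (hu : ∀ i, (u i).totalDegree ≤ a) (hv : ∀ i, (v i).totalDegree ≤ b) :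
    (u ⬝ᵥ v).totalDegree ≤ a + b :=
  totalDegree_finsetSum_le fun i _ => (totalDegree_mul _ _).trans (add_le_add (hu i) (hv i))

lemma totalDegree_moment_le {B : Matrix (Fin n) (Fin n) (MvPolynomial σ F)}
    {u v : Fin n → MvPolynomial σ F} (hB : ∀ i j, (B i j).totalDegree ≤ 1)
    (hu : ∀ i, (u i).totalDegree ≤ 1) (hv : ∀ i, (v i).totalDegree ≤ 1) (j : ℕ) :
    (moment B u v j).totalDegree ≤ j + 2 := by
  have h : ∀ (j : ℕ) (i : Fin n), ((B ^ j *ᵥ v) i).totalDegree ≤ j + 1 := by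
    intro j
    induction j with
    | zero => simpa using hv
    | succ j ih =>
      intro i
      rw [pow_succ', ← Matrix.mulVec_mulVec]
      exact (totalDegree_dotProduct_le (hB i) ih).trans (by omega)
  exact (totalDegree_dotProduct_le hu (h j)).trans (by omega)

lemma totalDegree_det_le {M : Matrix (Fin r) (Fin r) (MvPolynomial σ F)} {d : ℕ}
    (hM : ∀ i j, (M i j).totalDegree ≤ d) : M.det.totalDegree ≤ r * d := by
  rw [Matrix.det_apply]
  refine totalDegree_finsetSum_le fun p _ => ?_
  have h1 : (∏ i, M (p i) i).totalDegree ≤ r * d :=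
    (totalDegree_finsetProd _ _).trans
      ((Finset.sum_le_sum fun i _ => hM (p i) i).trans (by simp))
  refine le_trans ?_ h1
  rcases Int.units_eq_one_or (Equiv.Perm.sign p) with h | h <;> simp [h]

/-- The moments that occur have index at most `2 n - 1`, hence degree at most `2 n + 1`, and `n (2 n
+ 1) ≤ 3 n²`. -/
lemma totalDegree_momentMinor_le (hr : r ≤ n) {B : Matrix (Fin n) (Fin n) (MvPolynomial σ F)}
    {u v : Fin n → MvPolynomial σ F} (hB : ∀ i j, (B i j).totalDegree ≤ 1)
    (hu : ∀ i, (u i).totalDegree ≤ 1) (hv : ∀ i, (v i).totalDegree ≤ 1) :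
    (momentMinor hr B u v).totalDegree ≤ 3 * n ^ 2 := by
  rcases Nat.eq_zero_or_pos r with rfl | hr0
  · simp [momentMinor]
  · refine (totalDegree_det_le (d := 2 * n + 1) fun i j => ?_).trans (by nlinarith)
    exact (totalDegree_moment_le hB hu hv _).trans (by simp; omega)

/-- The Schwartz–Zippel lemma, for all points over a finite field. -/
lemma ncard_zeros_div_le [Finite F] [Finite σ] {p : MvPolynomial σ F} (hp : p ≠ 0) :
    (Set.ncard {x : σ → F | eval x p = 0} : ℝ) / (Nat.card (σ → F) : ℝ) ≤
      (p.totalDegree : ℝ) / (Nat.card F : ℝ) := by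
  classical
  have := Fintype.ofFinite F
  have := Fintype.ofFinite σ
  let e := Fintype.equivFin σ
  have hp' : rename e p ≠ 0 := by
    rwa [Ne, map_eq_zero_iff _ (rename_injective e e.injective)]
  have h1 := schwartz_zippel_totalDegree hp' (Finset.univ : Finset F)
  have h2 : (rename e p).totalDegree = p.totalDegree := totalDegree_renameEquiv e p
  rw [h2] at h1
  have h3 : Set.ncard {x : σ → F | eval x p = 0} =
      (Finset.filter (fun f : Fin (Fintype.card σ) → F => eval f (rename e p) = 0)
        (Fintype.piFinset fun _ => Finset.univ)).card := by
    rw [← Set.ncard_coe_finset]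
    refine Set.ncard_congr (fun x _ => x ∘ e.symm) ?_ ?_ ?_
    · intro x hx
      simp only [Set.mem_ofPred_eq] at hx
      simp [eval_rename, Function.comp_assoc, hx]
    · intro x y _ _ hxy
      funext i
      simpa using congrFun hxy (e i)
    · intro y hy
      refine ⟨y ∘ e, ?_, by funext i; simp⟩
      simpa [eval_rename] using hy
  have h4 : ((Finset.filter (fun f : Fin (Fintype.card σ) → F => eval f (rename e p) = 0)
      (Fintype.piFinset fun _ => Finset.univ)).card : ℝ) /
        ((Finset.univ : Finset F).card : ℝ) ^ (Fintype.card σ) ≤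
        (p.totalDegree : ℝ) / ((Finset.univ : Finset F).card : ℝ) := by
    have h5 := (NNRat.cast_le (K := ℝ)).2 h1
    push_cast at h5
    exact h5
  rw [h3, Nat.card_fun, Nat.card_eq_fintype_card, Nat.card_eq_fintype_card]
  push_cast
  simpa using h4

end Polynomial

/-! ### Matrices for which the minors do not vanish -/

section Witness

variable {n r : ℕ} {F : Type*} [Field F]

/-- Entry `(i, j)` is `1` exactly when `i + j + 1 ≡ 1` modulo `r`. This is the permutation matrix of
the involution `i ↦ -i`, whose square is the identity. -/
lemma momentMinor_ne_zero [NeZero r] (hr : r ≤ n) {B : Matrix (Fin n) (Fin n) F}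
    {u v : Fin n → F} (h : ∀ j : ℕ, moment B u v j = if Fin.ofNat r j = 1 then 1 else 0) :
    momentMinor hr B u v ≠ 0 := by
  have h1 : (hankel n (moment B u v) 1).submatrix (Fin.castLE hr) (Fin.castLE hr) =
      Matrix.of fun i j : Fin r => if j = -i then 1 else 0 := by
    ext i j
    simp only [hankel, Matrix.submatrix_apply, Matrix.of_apply, h, Fin.val_castLE]
    have : Fin.ofNat r (i + j + 1) = i + j + 1 := by
      apply Fin.ext
      simp [Fin.val_add, Fin.ofNat]
    have h2 : i + j + 1 = 1 ↔ j = -i := by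
      rw [eq_neg_iff_add_eq_zero, add_comm j i, add_eq_right]
    simp only [this, h2]
  rw [momentMinor, h1]
  intro h2
  have h3 : (Matrix.of fun i j : Fin r => if j = -i then (1 : F) else 0) *
      (Matrix.of fun i j : Fin r => if j = -i then (1 : F) else 0) = 1 := by
    ext i j
    simp only [Matrix.mul_apply, Matrix.one_apply, Matrix.of_apply, ite_mul, one_mul, zero_mul,
      Finset.sum_ite_eq', Finset.mem_univ, if_true, neg_neg, eq_comm]
  have h4 := congrArg Matrix.det h3
  rw [Matrix.det_mul, h2] at h4
  simp at h4

/-- Choose `U` with `U p_i = x_{i+1}`, indices modulo `r`. Then `A U` shifts the `p_i` cyclically,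
and with `u` the coordinate of `p_1` the moments starting from `p_0` are the indicator of `j ≡ 1`.
-/
lemma exists_momentMinor_ne_zero [NeZero r] (hr : r ≤ n) (A : Matrix (Fin n) (Fin n) F)
    {p x : Fin r → Fin n → F} (hp : LinearIndependent F p) (hx : ∀ i, A *ᵥ x i = p i) :
    ∃ (U : Matrix (Fin n) (Fin n) F) (u : Fin n → F), momentMinor hr (A * U) u (p 0) ≠ 0 := by
  -- `Q` extends the coordinates with respect to `p` to the whole space.
  obtain ⟨Q, hQ⟩ := LinearMap.exists_leftInverse_of_injective
    (Fintype.linearCombination F p) (LinearMap.ker_eq_bot.2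
      (linearIndependent_iff_injective_fintypeLinearCombination.1 hp))
  have hQp : ∀ i, Q (p i) = Pi.single i 1 := by
    intro i
    have := LinearMap.congr_fun hQ (Pi.single i 1)
    simpa [Fintype.linearCombination_apply_single] using this
  let f : (Fin n → F) →ₗ[F] Fin n → F :=
    (Fintype.linearCombination F fun i => x (i + 1)) ∘ₗ Q
  have hf : ∀ i, f (p i) = x (i + 1) := by
    intro i
    simp [f, hQp, Fintype.linearCombination_apply_single]
  refine ⟨LinearMap.toMatrix' f, fun i => Q (Pi.single i 1) 1,
    momentMinor_ne_zero hr fun j => ?_⟩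
  have h1 : ∀ j : ℕ, (A * LinearMap.toMatrix' f) ^ j *ᵥ p 0 = p (Fin.ofNat r j) := by
    intro j
    induction j with
    | zero => simp
    | succ j ih =>
      rw [pow_succ', ← Matrix.mulVec_mulVec, ih, ← Matrix.mulVec_mulVec,
        LinearMap.toMatrix'_mulVec, hf, hx]
      congr 1
      apply Fin.ext
      simp [Fin.val_add, Fin.ofNat]
  have h2 : ∀ y : Fin n → F, (fun i => Q (Pi.single i 1) 1) ⬝ᵥ y = Q y 1 := by
    intro y
    conv_rhs => rw [pi_eq_sum_univ' y]
    simp [dotProduct, mul_comm, Finset.sum_apply]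
  rw [moment, h1, h2, hQp, Pi.single_apply]
  simp only [eq_comm]

/-- The cyclic shift acts on a basis of the image of `A`; for rank `0` the minor is an empty
determinant. -/
lemma exists_momentMinor_rank_ne_zero (A : Matrix (Fin n) (Fin n) F) (hr : A.rank ≤ n) :
    ∃ (U : Matrix (Fin n) (Fin n) F) (u v : Fin n → F), momentMinor hr (A * U) u v ≠ 0 := by
  rcases Nat.eq_zero_or_pos A.rank with h0 | h0
  · refine ⟨0, 0, 0, ?_⟩
    have : IsEmpty (Fin A.rank) := by rw [h0]; infer_instance
    rw [momentMinor, Matrix.det_isEmpty]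
    exact one_ne_zero
  · have : NeZero A.rank := ⟨h0.ne'⟩
    let b := Module.finBasisOfFinrankEq F (LinearMap.range A.mulVecLin) (n := A.rank)
      (by rw [Matrix.rank])
    have h1 : ∀ i, ∃ x, A *ᵥ x = (b i : Fin n → F) := fun i => by
      obtain ⟨y, hy⟩ := (b i).2
      exact ⟨y, hy⟩
    choose x hx using h1
    have hp : LinearIndependent F fun i => (b i : Fin n → F) :=
      b.linearIndependent.map' (Submodule.subtype _) (Submodule.ker_subtype _)
    obtain ⟨U, u, h⟩ := exists_momentMinor_ne_zero hr A hp hx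
    exact ⟨U, u, _, h⟩

/-- In a linear system the starting vector is the given `b`, so the shifted basis has to begin with
`b`. -/
lemma exists_momentMinor_unit_ne_zero {A : Matrix (Fin n) (Fin n) F} (hA : IsUnit A)
    {b : Fin n → F} (hb : b ≠ 0) :
    ∃ (U : Matrix (Fin n) (Fin n) F) (u : Fin n → F),
      momentMinor le_rfl (A * U) u b ≠ 0 := by
  classical
  have hn : NeZero n := ⟨by
    rintro rfl
    exact hb (Subsingleton.elim _ _)⟩
  have hs : LinearIndepOn F id {b} := LinearIndepOn.singleton (v := id) hb
  let B := Module.Basis.extend hs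
  have := Module.Finite.finite_basis B
  have := Fintype.ofFinite (hs.extend (Set.subset_univ {b}))
  have hcard : Fintype.card (hs.extend (Set.subset_univ {b})) = n := by
    rw [← Module.finrank_eq_card_basis B, Module.finrank_fin_fun]
  let e := Fintype.equivFinOfCardEq hcard
  let b' : hs.extend (Set.subset_univ {b}) :=
    ⟨b, hs.subset_extend _ (Set.mem_singleton b)⟩
  let B' := B.reindex (e.trans (Equiv.swap (e b') 0))
  have h0 : B' 0 = b := by
    simp [B', B, b']
  obtain ⟨U, u, h⟩ := exists_momentMinor_ne_zero le_rfl A (p := B')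
    (x := fun i => A⁻¹ *ᵥ B' i) B'.linearIndependent fun i => by
      rw [Matrix.mulVec_mulVec, Matrix.mul_nonsing_inv _ ((Matrix.isUnit_iff_isUnit_det _).1 hA),
        Matrix.one_mulVec]
  exact ⟨U, u, h0 ▸ h⟩

end Witness
/-! ### Random coins -/

section Coins

variable {n r : ℕ} {F : Type u}

/-- The random matrix whose rows are given by the coins of the nodes. -/
def coinMatrix (x : Fin n → Fin n ⊕ Fin 2 → F) : Matrix (Fin n) (Fin n) F :=
  Matrix.of fun i j => x i (Sum.inl j)

/-- The two random vectors whose entries are given by the coins of the nodes. -/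
def coinVec (a : Fin 2) (x : Fin n → Fin n ⊕ Fin 2 → F) (i : Fin n) : F :=
  x i (Sum.inr a)

/-- The coins that give a matrix and two vectors. -/
def coinsOf (U : Matrix (Fin n) (Fin n) F) (u v : Fin n → F) (i : Fin n) : Fin n ⊕ Fin 2 → F :=
  Sum.elim (fun j => U i j) ![u i, v i]

lemma coinMatrix_coinsOf (U : Matrix (Fin n) (Fin n) F) (u v : Fin n → F) :
    coinMatrix (coinsOf U u v) = U := by
  ext i j
  simp [coinMatrix, coinsOf]

lemma coinVec_zero_coinsOf (U : Matrix (Fin n) (Fin n) F) (u v : Fin n → F) :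
    coinVec 0 (coinsOf U u v) = u := by
  funext i
  simp [coinVec, coinsOf]

lemma coinVec_one_coinsOf (U : Matrix (Fin n) (Fin n) F) (u v : Fin n → F) :
    coinVec 1 (coinsOf U u v) = v := by
  funext i
  simp [coinVec, coinsOf]

/-- The probability of an event for independent uniform coins. -/
noncomputable def coinProb (n : ℕ) (Coin : Type*) (S : Set (Fin n → Coin)) : ℝ :=
  (S.ncard : ℝ) / (Nat.card (Fin n → Coin) : ℝ)

lemma coinProb_mono {Coin : Type*} [Finite Coin] {S S' : Set (Fin n → Coin)} (h : S ⊆ S') :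
    coinProb n Coin S ≤ coinProb n Coin S' := by
  unfold coinProb
  gcongr
  exact Set.toFinite _

lemma coinProb_union_le {Coin : Type*} (S S' : Set (Fin n → Coin)) :
    coinProb n Coin (S ∪ S') ≤ coinProb n Coin S + coinProb n Coin S' := by
  unfold coinProb
  rw [← add_div]
  gcongr
  exact_mod_cast Set.ncard_union_le S S'

lemma coinProb_empty {Coin : Type*} : coinProb n Coin ∅ = 0 := by
  simp [coinProb]

variable [Field F]

-- The starting vector enters through polynomials `p` of degree at most `1`, which covers both a
-- random vector and a fixed one.
open MvPolynomial in
lemma coinProb_momentMinor_le [Finite F] (hr : r ≤ n) (A : Matrix (Fin n) (Fin n) F)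
    {v : (Fin n → Fin n ⊕ Fin 2 → F) → Fin n → F}
    {p : Fin n → MvPolynomial (Fin n × (Fin n ⊕ Fin 2)) F} (hp : ∀ i, (p i).totalDegree ≤ 1)
    (hv : ∀ x i, v x i = eval (fun a => x a.1 a.2) (p i))
    (hex : ∃ x, momentMinor hr (A * coinMatrix x) (coinVec 0 x) (v x) ≠ 0) :
    coinProb n (Fin n ⊕ Fin 2 → F)
      {x | momentMinor hr (A * coinMatrix x) (coinVec 0 x) (v x) = 0} ≤
        3 * (n : ℝ) ^ 2 / (Nat.card F : ℝ) := by
  let P : MvPolynomial (Fin n × (Fin n ⊕ Fin 2)) F := momentMinor hr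
    (A.map C * Matrix.of fun i j => X (i, Sum.inl j)) (fun i => X (i, Sum.inr 0)) p
  have hP : ∀ x : Fin n → Fin n ⊕ Fin 2 → F, eval (fun a => x a.1 a.2) P =
      momentMinor hr (A * coinMatrix x) (coinVec 0 x) (v x) := by
    intro x
    rw [momentMinor_map]
    congr 1
    · ext i j
      simp [Matrix.mul_apply, coinMatrix, map_sum]
    · funext i
      simp [coinVec]
    · funext i
      simp [hv]
  obtain ⟨x₀, hx₀⟩ := hex
  have hP0 : P ≠ 0 := by
    intro h
    rw [← hP, h, map_zero] at hx₀
    exact hx₀ rfl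
  have hdeg : P.totalDegree ≤ 3 * n ^ 2 := by
    refine totalDegree_momentMinor_le hr (fun i j => ?_) (fun i => ?_) hp
    · refine totalDegree_finsetSum_le fun k _ => (totalDegree_mul _ _).trans ?_
      simp [totalDegree_X]
    · simp [totalDegree_X]
  have h1 := ncard_zeros_div_le hP0
  have hcard : Nat.card (Fin n → Fin n ⊕ Fin 2 → F) =
      Nat.card (Fin n × (Fin n ⊕ Fin 2) → F) :=
    Nat.card_congr (Equiv.curry (Fin n) (Fin n ⊕ Fin 2) F).symm
  have hn : Set.ncard {x | momentMinor hr (A * coinMatrix x) (coinVec 0 x) (v x) = 0} =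
      Set.ncard {x : Fin n × (Fin n ⊕ Fin 2) → F | eval x P = 0} := by
    refine Set.ncard_congr (fun x _ a => x a.1 a.2) ?_ ?_ ?_
    · intro x hx
      rw [Set.mem_ofPred_eq] at hx ⊢
      rw [hP, hx]
    · intro x y _ _ hxy
      funext i j
      exact congrFun hxy (i, j)
    · intro y hy
      refine ⟨fun i j => y (i, j), ?_, rfl⟩
      rw [Set.mem_ofPred_eq] at hy ⊢
      rw [← hP]
      exact hy
  rw [coinProb, hn, hcard]
  refine h1.trans ?_
  gcongr
  exact_mod_cast hdeg

open MvPolynomial in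
lemma coinProb_momentMinor_coinVec_le [Finite F] (hr : r ≤ n) (A : Matrix (Fin n) (Fin n) F)
    (hex : ∃ U u v, momentMinor hr (A * U) u v ≠ 0) :
    coinProb n (Fin n ⊕ Fin 2 → F)
      {x | momentMinor hr (A * coinMatrix x) (coinVec 0 x) (coinVec 1 x) = 0} ≤
        3 * (n : ℝ) ^ 2 / (Nat.card F : ℝ) := by
  obtain ⟨U, u, v, h⟩ := hex
  refine coinProb_momentMinor_le hr A (p := fun i => X (i, Sum.inr 1))
    (fun i => by simp [totalDegree_X]) (fun x i => by simp [coinVec]) ⟨coinsOf U u v, ?_⟩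
  rwa [coinMatrix_coinsOf, coinVec_zero_coinsOf, coinVec_one_coinsOf]

open MvPolynomial in
lemma coinProb_momentMinor_const_le [Finite F] (hr : r ≤ n) (A : Matrix (Fin n) (Fin n) F)
    (b : Fin n → F) (hex : ∃ U u, momentMinor hr (A * U) u b ≠ 0) :
    coinProb n (Fin n ⊕ Fin 2 → F)
      {x | momentMinor hr (A * coinMatrix x) (coinVec 0 x) b = 0} ≤
        3 * (n : ℝ) ^ 2 / (Nat.card F : ℝ) := by
  obtain ⟨U, u, h⟩ := hex
  refine coinProb_momentMinor_le hr A (v := fun _ => b) (p := fun i => C (b i))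
    (fun i => by simp) (fun x i => by simp) ⟨coinsOf U u 0, ?_⟩
  rwa [coinMatrix_coinsOf, coinVec_zero_coinsOf]


end Coins

/-! ### The three problems -/

section Problems

variable {n β w M : ℕ} {F : Type u} [Field F]

lemma solvableInRounds_of_reach (prob : Problem.{u, w} n) {Coin : Type u} [Finite Coin]
    [Nonempty Coin] {T : ℕ} {δ : ℝ}
    {out : prob.Instance × (Fin n → Coin) → Fin n → prob.LocalOutput}
    (h : Reach β T (fun ω l => (prob.localInput ω.1 l, ω.2 l)) out)
    (hδ : ∀ X, coinProb n Coin {x | ¬ prob.Correct X (out (X, x))} ≤ δ) :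
    SolvableInRounds prob β T δ := by
  obtain ⟨f, hf, hfX⟩ := h
  obtain ⟨P, hP⟩ := hf.exists_protocol
  refine ⟨P, fun X => ?_⟩
  rw [hP]
  have := hδ X
  simp only [hfX] at this
  exact this

/-- All nodes learn a matrix of which each node knows a row. -/
lemma reach_all [Finite F] (hn : 1 ≤ n)
    (hF : n ≠ 1 → Nat.card F ≤ 2 ^ (β * Nat.clog 2 n * w)) {Ω : Type*}
    (A : Ω → Matrix (Fin n) (Fin n) F) :
    Reach β (if n = 1 then 0 else n * w) (fun ω l m => A ω l m) fun ω _ => A ω := by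
  split_ifs with h
  -- For `n = 1` messages have no bits, but the only row is the whole matrix.
  · subst h
    exact Reach.of_local (fun _ x => Matrix.of fun _ => x) fun ω l => by
      ext i j
      simp [Subsingleton.elim i l]
  · have h1 := Reach.pi (β := β) (X := fun ω l m => A ω l m) fun m : Fin n =>
      (Reach.broadcast (hF h) fun ω l => A ω l m).comap (X := fun ω l m => A ω l m)
        (fun _ x => x m) fun _ _ => rfl
    exact h1.map (fun _ x => Matrix.of fun i j => x j i) fun ω l => rfl

/-- Any problem about a matrix can be solved without error by collecting the matrix. -/
lemma solvableInRounds_zero [Finite F] (hn : 1 ≤ n)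
    (hF : n ≠ 1 → Nat.card F ≤ 2 ^ (β * Nat.clog 2 n * w)) (prob : Problem.{u, w} n)
    (A : prob.Instance → Matrix (Fin n) (Fin n) F) (row : prob.LocalInput → Fin n → F)
    (hrow : ∀ X l m, row (prob.localInput X l) m = A X l m)
    (solve : Fin n → Matrix (Fin n) (Fin n) F → prob.LocalInput → prob.LocalOutput)
    (hsolve : ∀ X, prob.Correct X fun l => solve l (A X) (prob.localInput X l)) :
    SolvableInRounds prob β (if n = 1 then 0 else n * w) 0 := by
  refine solvableInRounds_of_reach prob (Coin := PUnit)
    (out := fun ω l => solve l (A ω.1) (prob.localInput ω.1 l)) ?_ fun X => ?_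
  · have h1 := (reach_all hn hF fun ω : prob.Instance × (Fin n → PUnit) => A ω.1).comap
      (X := fun ω l => (prob.localInput ω.1 l, ω.2 l)) (fun _ x m => row x.1 m)
      fun ω l => funext fun m => (hrow ω.1 l m).symm
    exact h1.keep.map (fun l x => solve l x.2 x.1.1) fun _ _ => rfl
  · simp [hsolve, coinProb_empty]

variable [Finite F]

lemma coinProb_det_le (hn : 1 ≤ n) {A : Matrix (Fin n) (Fin n) F} (hA : IsUnit A) :
    coinProb n (Fin n ⊕ Fin 2 → F)
      {x | (hankel n (moment (A * coinMatrix x) (coinVec 0 x) (coinVec 1 x)) 1).det = 0} ≤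
        3 * (n : ℝ) ^ 2 / (Nat.card F : ℝ) := by
  have hne : (fun _ : Fin n => (1 : F)) ≠ 0 := fun h => one_ne_zero (congrFun h ⟨0, hn⟩)
  obtain ⟨U, u, h⟩ := exists_momentMinor_unit_ne_zero hA hne
  exact coinProb_momentMinor_coinVec_le le_rfl A ⟨U, u, _, h⟩

/-- No node knows all of `U`, so `det U` is computed from moments of `U` with the same coins. Hence
`15 = 8 + 7` in the rounds, and `6 = 3 + 3` from the union bound. -/
lemma solvableInRounds_det (hF : Nat.card F ≤ 2 ^ (β * Nat.clog 2 n * w))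
    (hM : MulRounds n β F M) (hw : w ≤ M) (hn : 1 ≤ n) :
    SolvableInRounds (DET n F) β (15 * (Nat.clog 2 (2 * n) * M))
      (6 * (n : ℝ) ^ 2 / (Nat.card F : ℝ)) := by
  let s : (Matrix (Fin n) (Fin n) F × (Fin n → Fin n ⊕ Fin 2 → F)) → ℕ → F := fun ω =>
    moment (ω.1 * coinMatrix ω.2) (coinVec 0 ω.2) (coinVec 1 ω.2)
  let s' : (Matrix (Fin n) (Fin n) F × (Fin n → Fin n ⊕ Fin 2 → F)) → ℕ → F := fun ω =>
    moment (coinMatrix ω.2) (coinVec 0 ω.2) (coinVec 1 ω.2)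
  refine solvableInRounds_of_reach (DET n F) (Coin := Fin n ⊕ Fin 2 → F)
    (out := fun ω _ => (hankel n (s ω) 1).det / (hankel n (s ω) 0).det /
      ((hankel n (s' ω) 1).det / (hankel n (s' ω) 0).det)) ?_
        fun A : Matrix (Fin n) (Fin n) F => ?_
  · have h1 := (hM.moments_mul hF hw hn
      (Ω := Matrix (Fin n) (Fin n) F × (Fin n → Fin n ⊕ Fin 2 → F))
      (fun ω => ω.1) (fun ω => coinMatrix ω.2) (fun ω => coinVec 0 ω.2)
      (fun ω => coinVec 1 ω.2)).comap
      (X := fun ω l => (rowAndColumn ω.1 l, ω.2 l))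
      (fun _ x => (x.1.1, fun m => x.2 (Sum.inl m), x.2 (Sum.inr 0), x.2 (Sum.inr 1)))
      fun _ _ => rfl
    have h2 := (hM.moments hF hw hn
      (Ω := Matrix (Fin n) (Fin n) F × (Fin n → Fin n ⊕ Fin 2 → F))
      (fun ω => coinMatrix ω.2) (fun ω => coinVec 0 ω.2) (fun ω => coinVec 1 ω.2)).comap
      (X := fun ω l => (rowAndColumn ω.1 l, ω.2 l))
      (fun _ x => (fun m => x.2 (Sum.inl m), x.2 (Sum.inr 0), x.2 (Sum.inr 1)))
      fun _ _ => rfl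
    refine ((h1.prod h2).map (fun _ x => (hankel n x.1.2 1).det / (hankel n x.1.2 0).det /
      ((hankel n x.2.2 1).det / (hankel n x.2.2 0).det)) fun ω l => ?_).mono
      (le_of_eq (by ring))
    simp only [hankel_truncate _ le_rfl, hankel_truncate _ zero_le_one, s, s']
  · have hU := coinProb_det_le hn (A := (1 : Matrix (Fin n) (Fin n) F)) isUnit_one
    simp only [one_mul] at hU
    have hadd : 6 * (n : ℝ) ^ 2 / (Nat.card F : ℝ) =
        3 * (n : ℝ) ^ 2 / (Nat.card F : ℝ) + 3 * (n : ℝ) ^ 2 / (Nat.card F : ℝ) := by ring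
    have hcorrect : ∀ x, (IsUnit A → (hankel n (s (A, x)) 1).det ≠ 0) →
        (hankel n (s' (A, x)) 1).det ≠ 0 →
        (hankel n (s (A, x)) 1).det / (hankel n (s (A, x)) 0).det /
          ((hankel n (s' (A, x)) 1).det / (hankel n (s' (A, x)) 0).det) = A.det := by
      intro x h1 h2
      -- The good event for `U` also certifies that the divisor `det U` is not zero.
      have h3 : (coinMatrix x).det ≠ 0 := by
        intro h
        rw [show s' (A, x) = moment (coinMatrix x) (coinVec 0 x) (coinVec 1 x) from rfl,
          hankel_moment, pow_one, Matrix.det_mul, Matrix.det_mul, h] at h2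
        simp at h2
      have h4 := det_hankel_div (B := coinMatrix x) (u := coinVec 0 x) (v := coinVec 1 x)
        fun _ => h2
      have h5 := det_hankel_div (B := A * coinMatrix x) (u := coinVec 0 x) (v := coinVec 1 x)
        fun h => h1 ((Matrix.isUnit_iff_isUnit_det A).2 (isUnit_iff_ne_zero.2 fun hA =>
          h (by rw [Matrix.det_mul, hA, zero_mul])))
      simp only [s, s']
      rw [h4, h5, Matrix.det_mul, mul_div_cancel_right₀ _ h3]
    have hsub : {x | ¬ (DET n F).Correct A (fun _ => (hankel n (s (A, x)) 1).det /
        (hankel n (s (A, x)) 0).det /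
          ((hankel n (s' (A, x)) 1).det / (hankel n (s' (A, x)) 0).det))} ⊆
        {x | IsUnit A ∧ (hankel n (s (A, x)) 1).det = 0} ∪
          {x | (hankel n (s' (A, x)) 1).det = 0} := by
      intro x hx
      by_contra hx'
      simp only [Set.mem_union, Set.mem_ofPred_eq, not_or, not_and] at hx'
      exact hx fun _ => hcorrect x hx'.1 hx'.2
    rw [hadd]
    refine (coinProb_mono hsub).trans ((coinProb_union_le _ _).trans (add_le_add ?_ hU))
    by_cases hA : IsUnit A
    · simpa only [hA, true_and] using coinProb_det_le hn hA
    · simp only [hA, false_and, Set.ofPred_false, coinProb_empty]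
      positivity

lemma solvableInRounds_rank (hF : Nat.card F ≤ 2 ^ (β * Nat.clog 2 n * w))
    (hM : MulRounds n β F M) (hw : w ≤ M) (hn : 1 ≤ n) :
    SolvableInRounds (RANK n F) β (8 * (Nat.clog 2 (2 * n) * M))
      (3 * (n : ℝ) ^ 2 / (Nat.card F : ℝ)) := by
  refine solvableInRounds_of_reach (RANK n F) (Coin := Fin n ⊕ Fin 2 → F)
    (out := fun (ω : Matrix (Fin n) (Fin n) F × (Fin n → Fin n ⊕ Fin 2 → F)) _ => (hankel n
      (moment (ω.1 * coinMatrix ω.2) (coinVec 0 ω.2) (coinVec 1 ω.2)) 1).rank) ?_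
      fun A : Matrix (Fin n) (Fin n) F => ?_
  · have h1 := (hM.moments_mul hF hw hn
      (Ω := Matrix (Fin n) (Fin n) F × (Fin n → Fin n ⊕ Fin 2 → F))
      (fun ω => ω.1) (fun ω => coinMatrix ω.2) (fun ω => coinVec 0 ω.2)
      (fun ω => coinVec 1 ω.2)).comap
      (X := fun ω l => (rowAndColumn ω.1 l, ω.2 l))
      (fun _ x => (x.1.1, fun m => x.2 (Sum.inl m), x.2 (Sum.inr 0), x.2 (Sum.inr 1)))
      fun _ _ => rfl
    refine h1.map (fun _ x => (hankel n x.2 1).rank) fun ω l => ?_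
    simp only [hankel_truncate _ le_rfl]
    rfl
  · have hr : Matrix.rank A ≤ n := by simpa using Matrix.rank_le_card_width A
    have hsub : {x | ¬ (RANK n F).Correct A fun _ => (hankel n
        (moment (A * coinMatrix x) (coinVec 0 x) (coinVec 1 x)) 1).rank} ⊆
        {x | momentMinor hr (A * coinMatrix x) (coinVec 0 x) (coinVec 1 x) = 0} := by
      intro x hx
      by_contra hx'
      exact hx fun _ => rank_hankel_eq rfl hr hx'
    exact (coinProb_mono hsub).trans
      (coinProb_momentMinor_coinVec_le hr A (exists_momentMinor_rank_ne_zero A hr))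

/-- Node `l` holds row `l` of `R`, so it finds its entry of `y = R H⁻¹ L b` alone. The solution `U
y` requires one broadcast of `y`, which raises `8` to `9`. -/
lemma solvableInRounds_sys (hF : Nat.card F ≤ 2 ^ (β * Nat.clog 2 n * w))
    (hM : MulRounds n β F M) (hw : w ≤ M) (hn : 1 ≤ n) :
    SolvableInRounds (SYS n F) β (9 * (Nat.clog 2 (2 * n) * M))
      (3 * (n : ℝ) ^ 2 / (Nat.card F : ℝ)) := by
  let Ω := ({A : Matrix (Fin n) (Fin n) F // IsUnit A} × (Fin n → F)) × (Fin n → Fin n ⊕ Fin 2 → F)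
  let s : Ω → ℕ → F := fun ω => moment (ω.1.1.1 * coinMatrix ω.2) (coinVec 0 ω.2) ω.1.2
  let y : Ω → Fin n → F := fun ω => krylovCols (ω.1.1.1 * coinMatrix ω.2) ω.1.2 *ᵥ
    ((hankel n (s ω) 1)⁻¹ *ᵥ fun i => s ω i)
  let z : Ω → Fin n → F := fun ω => coinMatrix ω.2 *ᵥ y ω
  refine solvableInRounds_of_reach (SYS n F) (Coin := Fin n ⊕ Fin 2 → F)
    (out := z) ?_ fun X => ?_
  · have h1 := (hM.moments_mul hF hw hn (Ω := Ω)
      (fun ω => ω.1.1.1) (fun ω => coinMatrix ω.2) (fun ω => coinVec 0 ω.2)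
      (fun ω => ω.1.2)).comap
      (X := fun ω l => ((SYS n F).localInput ω.1 l, ω.2 l))
      (fun l x => (x.1.1.1, fun m => x.2 (Sum.inl m), x.2 (Sum.inr 0), x.1.2 l))
      fun _ _ => rfl
    have h2 := h1.map (Z := y) (fun l x => ∑ j : Fin n, x.1 j *
      ((hankel n x.2 1)⁻¹ *ᵥ fun i : Fin n => x.2 i) j) fun ω l => by
        have h3 : ∀ i : Fin n, (i : ℕ) < 2 * n := fun i => by omega
        simp only [hankel_truncate _ le_rfl, y, krylov, h3, if_true]
        rfl
    have hk : 1 ≤ Nat.clog 2 (2 * n) := Nat.clog_pos (by norm_num) (by omega)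
    have hle : 8 * (Nat.clog 2 (2 * n) * M) + w ≤ 9 * (Nat.clog 2 (2 * n) * M) := by nlinarith
    have h3 := (h2.trans (Reach.broadcast hF y)).keep.map
      (Z := z)
      (fun _ x => ∑ m, x.1.2 (Sum.inl m) * x.2 m) fun _ _ => rfl
    exact h3.mono hle
  · obtain ⟨⟨A, hA⟩, b⟩ := X
    have hcorrect : ∀ x, (b ≠ 0 → momentMinor le_rfl (A * coinMatrix x) (coinVec 0 x) b ≠ 0) →
        A *ᵥ (coinMatrix x *ᵥ y ((⟨A, hA⟩, b), x)) = b := fun x hx => by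
      rw [Matrix.mulVec_mulVec]
      exact mulVec_krylovCols_eq hx
    have hsub : {x | ¬ (SYS n F).Correct (⟨A, hA⟩, b) (z ((⟨A, hA⟩, b), x))} ⊆
        {x | b ≠ 0 ∧ momentMinor le_rfl (A * coinMatrix x) (coinVec 0 x) b = 0} := by
      intro x hx
      by_contra hx'
      exact hx (hcorrect x fun hb h => hx' ⟨hb, h⟩)
    refine (coinProb_mono hsub).trans ?_
    by_cases hb : b = 0
    · simp only [hb, ne_eq, not_true, false_and, Set.ofPred_false, coinProb_empty]
      positivity
    · simpa only [ne_eq, hb, not_false_eq_true, true_and] using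
        coinProb_momentMinor_const_le le_rfl A b (exists_momentMinor_unit_ne_zero hA hb)

end Problems

/-! ### Round complexity -/

/-- With `k` one less than the left side, `2 ^ k < 2 * n` gives `k ≤ 2 log n / log 2`. The left side
is thus at most `3 log n / log 2`, and `3 / log 2 < 5`. -/
lemma clog_two_mul_le {n : ℕ} (hn : 2 ≤ n) : (Nat.clog 2 (2 * n) : ℝ) ≤ 5 * Real.log n := by
  have h1 : 2 ^ (Nat.clog 2 (2 * n)).pred < 2 * n :=
    Nat.pow_pred_clog_lt_self (by norm_num) (by omega)
  have hk : 1 ≤ Nat.clog 2 (2 * n) := Nat.clog_pos (by norm_num) (by omega)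
  obtain ⟨k, hk⟩ : ∃ k, Nat.clog 2 (2 * n) = k + 1 := ⟨_, (Nat.sub_add_cancel hk).symm⟩
  rw [hk, Nat.pred_succ] at h1
  rw [hk]
  have h2 : ((2 : ℝ) ^ k) ≤ 2 * n := by exact_mod_cast h1.le
  have hn0 : (2 : ℝ) ≤ n := by exact_mod_cast hn
  have h3 := Real.log_le_log (by positivity) h2
  rw [Real.log_pow, Real.log_mul (by norm_num) (by linarith)] at h3
  have h4 := Real.log_le_log (by norm_num) hn0
  have h5 := Real.log_two_gt_d9
  push_cast
  nlinarith [Nat.cast_nonneg (α := ℝ) k]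

/-- A field element fits into a constant number of messages: `n ^ k` takes `k` words, and `K < 2 ^
a` at most `a` more. -/
lemma exists_word_size (K : ℝ) (k β : ℕ) (hβ : 1 ≤ β) : ∃ w : ℕ, ∀ n q : ℕ, 2 ≤ n →
    (q : ℝ) ≤ K * (n : ℝ) ^ k → q ≤ 2 ^ (β * Nat.clog 2 n * w) := by
  obtain ⟨a, ha⟩ := pow_unbounded_of_one_lt K (one_lt_two (α := ℝ))
  refine ⟨k + a, fun n q hn hq => ?_⟩
  have h1 : n ≤ 2 ^ Nat.clog 2 n := Nat.le_pow_clog (by norm_num) n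
  have h2 : 1 ≤ Nat.clog 2 n := Nat.clog_pos (by norm_num) hn
  have h3 : (q : ℝ) ≤ ((2 ^ (a + Nat.clog 2 n * k) : ℕ) : ℝ) := by
    push_cast
    rw [pow_add, pow_mul]
    refine hq.trans ?_
    have h1' : (n : ℝ) ≤ 2 ^ Nat.clog 2 n := by exact_mod_cast h1
    gcongr
  have h4 : q ≤ 2 ^ (a + Nat.clog 2 n * k) := by exact_mod_cast h3
  refine h4.trans (Nat.pow_le_pow_right (by norm_num) ?_)
  have h5 : 1 * Nat.clog 2 n ≤ β * Nat.clog 2 n := Nat.mul_le_mul_right _ hβ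
  calc a + Nat.clog 2 n * k ≤ Nat.clog 2 n * a + Nat.clog 2 n * k := by nlinarith
    _ = 1 * Nat.clog 2 n * (k + a) := by ring
    _ ≤ _ := Nat.mul_le_mul_right _ h5

lemma SolvableInRounds.mono {n β T : ℕ} {prob : Problem.{u, w} n} {δ δ' : ℝ}
    (h : SolvableInRounds prob β T δ) (hδ : δ ≤ δ') : SolvableInRounds prob β T δ' := by
  obtain ⟨P, hP⟩ := h
  exact ⟨P, fun X => (hP X).trans hδ⟩

/-- Problems have low round complexity when they can be solved by collecting the input, and, with
failure probability `O(n² / |F|)`, by `O(log n)` matrix multiplications. -/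
lemma randomizedRoundComplexityO_of {ι : Type v} (F : ι → Type u) [∀ i, Field (F i)]
    [∀ i, Finite (F i)] {c K : ℝ} (hc : 0 < c) {k β : ℕ} (hβ : 1 ≤ β) {e τ : ℝ}
    (hτ : MatMulRankO F τ) (hτ2 : 2 ≤ τ) (he : 1 - 2 / τ ≤ e)
    (prob : (n : ℕ) → ι → Problem.{u, w} n) (a : ℕ)
    (hbase : ∀ n i w, 1 ≤ n → (n ≠ 1 → Nat.card (F i) ≤ 2 ^ (β * Nat.clog 2 n * w)) →
      SolvableInRounds (prob n i) β (if n = 1 then 0 else n * w) 0)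
    (hmain : ∀ n i w M, 1 ≤ n → Nat.card (F i) ≤ 2 ^ (β * Nat.clog 2 n * w) →
      MulRounds n β (F i) M → w ≤ M →
      SolvableInRounds (prob n i) β (a * (Nat.clog 2 (2 * n) * M))
        (6 * (n : ℝ) ^ 2 / (Nat.card (F i) : ℝ))) :
    RandomizedRoundComplexityO (FieldSizeAdmissible F c K k) prob β
      (fun n => (n : ℝ) ^ e * Real.log n) := by
  obtain ⟨w, hw⟩ := exists_word_size K k β hβ
  obtain ⟨C, hC, hMul⟩ := hτ.exists_mulRounds hτ2 β w
  have he0 : 0 ≤ 1 - 2 / τ := by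
    rw [sub_nonneg, div_le_one (by linarith)]
    exact hτ2
  set N := Real.exp (18 / c) with hN
  have hN0 : 0 < N := Real.exp_pos _
  -- The two summands serve the main case and the case `n ≤ N`; `6 / c` comes from `6 n² / |F| ≤ 6 /
  -- (c log n)`.
  refine ⟨5 * a * C + 2 * N * w, 6 / c, fun n i ⟨hn, hlow, hup⟩ => ?_⟩
  have hn1 : (1 : ℝ) ≤ n := by exact_mod_cast hn
  rcases eq_or_ne n 1 with rfl | hne
  -- As `log 1 = 0`, the bound allows no round at all.
  · refine ⟨0, 0, ?_, by norm_num, ?_, by simpa using hbase 1 i w le_rfl (by simp)⟩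
    · simp
    · simp only [zero_mul]
      positivity
  have hn2 : 2 ≤ n := by omega
  have hn2' : (2 : ℝ) ≤ n := by exact_mod_cast hn2
  have hF := hw n _ hn2 hup
  have hcard : (0 : ℝ) < Nat.card (F i) := by exact_mod_cast Nat.card_pos
  have hlog : 1 / 2 ≤ Real.log n := by
    have h1 := Real.log_le_log (by norm_num) hn2'
    have h2 := Real.log_two_gt_d9
    linarith
  have hpow : 1 ≤ (n : ℝ) ^ e := Real.one_le_rpow hn1 (he0.trans he)
  by_cases hδ : 6 * (n : ℝ) ^ 2 / (Nat.card (F i) : ℝ) ≤ 1 / 3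
  · obtain ⟨M, hwM, hMC, hM⟩ := hMul i n hn hF
    refine ⟨a * (Nat.clog 2 (2 * n) * M), _, ?_, hδ, ?_, hmain n i w M hn hF hM hwM⟩
    · have h1 := clog_two_mul_le hn2
      have h2 : (n : ℝ) ^ (1 - 2 / τ) ≤ (n : ℝ) ^ e := Real.rpow_le_rpow_of_exponent_le hn1 he
      push_cast
      calc (a : ℝ) * (Nat.clog 2 (2 * n) * M)
          ≤ a * (5 * Real.log n * (C * (n : ℝ) ^ e)) := by
            gcongr
            exact hMC.trans (by gcongr)
        _ = 5 * a * C * ((n : ℝ) ^ e * Real.log n) := by ring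
        _ ≤ _ := by
            gcongr
            have : 0 ≤ 2 * N * w := by positivity
            linarith
    · rw [div_mul_eq_mul_div, div_le_div_iff₀ hcard hc]
      linarith
  · refine ⟨n * w, 0, ?_, by norm_num, ?_, ?_⟩
    -- A failure bound above `1/3` means `c n² log n ≤ |F| < 18 n²`, so `n` is bounded and
    -- collecting the matrix takes constantly many rounds.
    · have h1 : (n : ℝ) ≤ N := by
        rw [not_le, div_lt_div_iff₀ (by norm_num) hcard] at hδ
        have hsq : (0 : ℝ) < (n : ℝ) ^ 2 := by positivity
        have h3 : c * Real.log n < 18 := by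
          refine lt_of_mul_lt_mul_right ?_ hsq.le
          linarith
        rw [hN, ← Real.log_le_iff_le_exp (by linarith), le_div_iff₀ hc]
        linarith
      push_cast
      calc (n : ℝ) * w ≤ N * w * (2 * (1 * (1 / 2))) := by
            have : (n : ℝ) * w ≤ N * w := by gcongr
            linarith
        _ ≤ N * w * (2 * ((n : ℝ) ^ e * Real.log n)) := by gcongr
        _ = 2 * N * w * ((n : ℝ) ^ e * Real.log n) := by ring
        _ ≤ _ := by
            have h0 : 0 ≤ Real.log n := by linarith
            gcongr
            have : 0 ≤ 5 * a * C := by positivity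
            linarith
    · simp only [zero_mul]
      positivity
    · simpa [hne] using hbase n i w hn fun _ => hF

end CongestedClique

theorem theorem3 {ι : Type v} (F : ι → Type u) [∀ i, Field (F i)] [∀ i, Finite (F i)]
    (c K : ℝ) (hc : 0 < c) (k β : ℕ) (hβ : 1 ≤ β) (e : ℝ)
    -- the exponent `1 - 2 / ω`, up to an arbitrarily small `ε`, or the exact `1 - 2 / τ` for
    -- every exponent `τ` for which the rank is `O(m ^ τ)`
    (he : (∃ ε : ℝ, 0 < ε ∧ e = 1 - 2 / matMulExponent F + ε) ∨
      (∃ τ : ℝ, MatMulRankO F τ ∧ e = 1 - 2 / τ)) :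
    RandomizedRoundComplexityO (FieldSizeAdmissible F c K k) (fun n i => DET n (F i)) β
        (fun n => (n : ℝ) ^ e * Real.log n) ∧
      RandomizedRoundComplexityO (FieldSizeAdmissible F c K k) (fun n i => SYS n (F i)) β
        (fun n => (n : ℝ) ^ e * Real.log n) ∧
      RandomizedRoundComplexityO (FieldSizeAdmissible F c K k) (fun n i => RANK n (F i)) β
        (fun n => (n : ℝ) ^ e * Real.log n) := by
  -- For an empty class every exponent is achieved and `2 ≤ τ` may fail, but there is nothing to
  -- solve.
  rcases isEmpty_or_nonempty ι with hι | hι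
  · exact ⟨⟨0, 0, fun _ i => hι.elim i⟩, ⟨0, 0, fun _ i => hι.elim i⟩,
      ⟨0, 0, fun _ i => hι.elim i⟩⟩
  obtain ⟨τ, hτ, hτ2, hle⟩ : ∃ τ, MatMulRankO F τ ∧ 2 ≤ τ ∧ 1 - 2 / τ ≤ e := by
    rcases he with ⟨ε, hε, rfl⟩ | ⟨τ, hτ, rfl⟩
    · exact exists_matMulRankO hε
    · exact ⟨τ, hτ, hτ.two_le, le_rfl⟩
  have h36 : ∀ (n : ℕ) (i : ι), 3 * (n : ℝ) ^ 2 / (Nat.card (F i) : ℝ) ≤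
      6 * (n : ℝ) ^ 2 / (Nat.card (F i) : ℝ) := fun n i => by
    gcongr
    norm_num
  refine ⟨randomizedRoundComplexityO_of F hc hβ hτ hτ2 hle (fun n i => DET n (F i)) 15 ?_ ?_,
    randomizedRoundComplexityO_of F hc hβ hτ hτ2 hle (fun n i => SYS n (F i)) 9 ?_ ?_,
    randomizedRoundComplexityO_of F hc hβ hτ hτ2 hle (fun n i => RANK n (F i)) 8 ?_ ?_⟩
  · exact fun n i w hn hF => solvableInRounds_zero hn hF (DET n (F i)) id (fun x => x.1)
      (fun _ _ _ => rfl) (fun _ A _ => A.det) fun _ _ => rfl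
  · exact fun n i w M hn hF hM hw => solvableInRounds_det hF hM hw hn
  · refine fun n i w hn hF => solvableInRounds_zero hn hF (SYS n (F i)) (fun X => X.1.1)
      (fun x => x.1.1) (fun _ _ _ => rfl) (fun l A x => (A⁻¹.mulVec x.2) l) fun X => ?_
    change X.1.1.mulVec (X.1.1⁻¹.mulVec X.2) = X.2
    rw [Matrix.mulVec_mulVec,
      Matrix.mul_nonsing_inv _ ((Matrix.isUnit_iff_isUnit_det _).1 X.1.2), Matrix.one_mulVec]
  · exact fun n i w M hn hF hM hw => (solvableInRounds_sys hF hM hw hn).mono (h36 n i)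
  · exact fun n i w hn hF => solvableInRounds_zero hn hF (RANK n (F i)) id (fun x => x.1)
      (fun _ _ _ => rfl) (fun _ A _ => A.rank) fun _ _ => rfl
  · exact fun n i w M hn hF hM hw => (solvableInRounds_rank hF hM hw hn).mono (h36 n i)
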